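/- Notation. Let $\dot{\mathscr B}$ be the space of smooth $\varphi:\mathbb R^n\to\mathbb C$ all of whose derivatives tend to $0$ at infinity, with the topology of uniform convergence of every derivative on $\mathbb R^n$, and let $\mathscr D'_{L^1}\subset\mathscr S'(\mathbb R^n)$ be its dual. Let $\mathscr B_c$ be the space of smooth functions on $\mathbb R^n$ with all derivatives bounded, with the finest locally convex topology that induces on the bounded subsets the topology inherited from $C^\infty(\mathbb R^n)$; every $u\in\mathscr D'_{L^1}$ extends uniquely to a continuous linear form on $\mathscr B_c$, and $\langle u,1\rangle$ denotes its value at the constant function $1$. For $\mu\in\mathbb R$ put $w^\mu(x)=(1+|x|^2)^{\mu/2}$ and $w^\mu\mathscr D'_{L^1}=\{u\in\mathscr S':w^{-\mu}u\in\mathscr D'_{L^1}\}$. For $\alpha>-1$ put $w_\alpha=w^{\alpha+n+1}$ and $$\mathcal K_{\alpha,y}(x)=\frac{\Gamma((\alpha+n+1)/2)}{\Gamma((\alpha+1)/2)\,\pi^{n/2}}\cdot\frac{y^{\alpha+1}}{(|x|^2+y^2)^{(\alpha+n+1)/2}},\qquad x\in\mathbb R^n,\ y>0.$$ Two distributions $u,v\in\mathscr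 S'$ are $\mathscr S'$-convolvable if $u(\check v*\varphi)\in\mathscr D'_{L^1}$ for all $\varphi\in\mathscr S$, where $(\check v*\varphi)(\eta)=\langle v,\varphi(\cdot+\eta)\rangle$; their $\mathscr S'$-convolution is then the tempered distribution $\varphi\mapsto\langle u(\check v*\varphi),1\rangle$. Theorem. Let $f\in\mathscr S'(\mathbb R^n)$. There is an integer $m\ge0$, depending only on $f$, such that the following holds for every $\alpha>-1$ with $f\in w_\alpha\mathscr D'_{L^1}$. For each $y>0$ the $\mathscr S'$-convolution of $f$ and $\mathcal K_{\alpha,y}$ exists and is given by a (necessarily unique) continuous function $x\mapsto\mathcal K_{\alpha,y}*f(x)$ on $\mathbb R^n$, and, with $S_r=\{(x,y)\in\mathbb R^n\times\mathbb R:\ y>0,\ |x|^2+y^2=r^2\}$, $$\sup_{(x,y)\in S_r}\bigl|\mathcal K_{\alpha,y}*f(x)\,\cos^{n+m}\vartheta\bigr|=o(r^{\alpha+1})\quad\text{as } r\to\infty$$ (in particular the supremum is finite for all large $r$), where $\vartheta\in[0,\pi/2)$ is the angle with $y=r\cos\vartheta$ and $|x|=r\sin\vartheta$. -/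

import Mathlib

open Filter Topology MeasureTheory
open scoped ContDiff SchwartzMap UniformConvergence

noncomputable section

namespace PoissonGrowth

/-- `ℝⁿ` with its Euclidean norm. -/
abbrev Rn (n : ℕ) : Type := EuclideanSpace ℝ (Fin n)

/-! ### The function spaces `𝓑` and `𝓑̇` -/

/-- The space `𝓑 = 𝓓_{L^∞}` of smooth functions `ℝⁿ → ℂ` all of whose derivatives are bounded. -/
def smoothBdd (n : ℕ) : Submodule ℂ (Rn n → ℂ) where
  carrier := {φ | ContDiff ℝ ∞ φ ∧ ∀ k : ℕ, ∃ C : ℝ, ∀ x, ‖iteratedFDeriv ℝ k φ x‖ ≤ C}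
  zero_mem' := by
    refine ⟨contDiff_const, fun k => ⟨0, fun x => ?_⟩⟩
    have : iteratedFDeriv ℝ k (0 : Rn n → ℂ) = 0 := iteratedFDeriv_fun_zero
    simp [this]
  add_mem' := by
    rintro φ ψ ⟨hφ, hφ'⟩ ⟨hψ, hψ'⟩
    refine ⟨hφ.add hψ, fun k => ?_⟩
    obtain ⟨C, hC⟩ := hφ' k
    obtain ⟨D, hD⟩ := hψ' k
    refine ⟨C + D, fun x => ?_⟩
    rw [iteratedFDeriv_add_apply (hφ.contDiffAt.of_le (mod_cast le_top))
      (hψ.contDiffAt.of_le (mod_cast le_top))]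
    exact (norm_add_le _ _).trans (add_le_add (hC x) (hD x))
  smul_mem' := by
    rintro c φ ⟨hφ, hφ'⟩
    refine ⟨hφ.const_smul c, fun k => ?_⟩
    obtain ⟨C, hC⟩ := hφ' k
    refine ⟨‖c‖ * C, fun x => ?_⟩
    rw [iteratedFDeriv_const_smul_apply (hφ.contDiffAt.of_le (mod_cast le_top)), norm_smul]
    exact mul_le_mul_of_nonneg_left (hC x) (norm_nonneg c)

/-- The space `𝓑̇` of smooth functions `ℝⁿ → ℂ` all of whose derivatives tend to `0` at infinity. -/
def smoothVanishing (n : ℕ) : Submodule ℂ (Rn n → ℂ) where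
  carrier := {φ | ContDiff ℝ ∞ φ ∧
    ∀ k : ℕ, Tendsto (fun x => iteratedFDeriv ℝ k φ x) (cocompact (Rn n)) (𝓝 0)}
  zero_mem' := by
    refine ⟨contDiff_const, fun k => ?_⟩
    have : iteratedFDeriv ℝ k (0 : Rn n → ℂ) = 0 := iteratedFDeriv_fun_zero
    simpa [this] using tendsto_const_nhds
  add_mem' := by
    rintro φ ψ ⟨hφ, hφ'⟩ ⟨hψ, hψ'⟩
    refine ⟨hφ.add hψ, fun k => ?_⟩
    have h := (hφ' k).add (hψ' k)
    rw [add_zero] at h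
    refine h.congr fun x => ?_
    rw [iteratedFDeriv_add_apply (hφ.contDiffAt.of_le (mod_cast le_top))
      (hψ.contDiffAt.of_le (mod_cast le_top))]
  smul_mem' := by
    rintro c φ ⟨hφ, hφ'⟩
    refine ⟨hφ.const_smul c, fun k => ?_⟩
    have h := (hφ' k).const_smul c
    rw [smul_zero] at h
    refine h.congr fun x => ?_
    rw [iteratedFDeriv_const_smul_apply (hφ.contDiffAt.of_le (mod_cast le_top))]

/-- The topology of `𝓑̇`: uniform convergence of every derivative on `ℝⁿ`. -/
abbrev vanishingTopology (n : ℕ) : TopologicalSpace (smoothVanishing n) :=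
  TopologicalSpace.induced
    (fun φ => fun k : ℕ => UniformFun.ofFun (iteratedFDeriv ℝ k (φ : Rn n → ℂ)))
    (inferInstance : TopologicalSpace ((k : ℕ) → (Rn n →ᵤ (Rn n [×k]→L[ℝ] ℂ))))

/-- The topology that `𝓑` inherits from `C^∞(ℝⁿ)`: uniform convergence of every derivative on
every compact set. -/
abbrev smoothTopology (n : ℕ) : TopologicalSpace (smoothBdd n) :=
  TopologicalSpace.induced
    (fun φ => fun k : ℕ =>
      UniformOnFun.ofFun {K : Set (Rn n) | IsCompact K} (iteratedFDeriv ℝ k (φ : Rn n → ℂ)))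
    (inferInstance : TopologicalSpace
      ((k : ℕ) → (Rn n →ᵤ[{K : Set (Rn n) | IsCompact K}] (Rn n [×k]→L[ℝ] ℂ))))

/-- Bounded subsets of `𝓑`: every derivative is bounded on `ℝⁿ`, uniformly over the set. -/
def IsBddSubset {n : ℕ} (S : Set (smoothBdd n)) : Prop :=
  ∀ k : ℕ, ∃ C : ℝ, ∀ φ ∈ S, ∀ x, ‖iteratedFDeriv ℝ k (φ : Rn n → ℂ) x‖ ≤ C

/-- `t` is a locally convex vector space topology on `𝓑` that induces on every bounded subset of
`𝓑` the topology inherited from `C^∞(ℝⁿ)`. -/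
def IsAdmissibleTopology {n : ℕ} (t : TopologicalSpace (smoothBdd n)) : Prop :=
  @IsTopologicalAddGroup _ t _ ∧ @ContinuousSMul ℂ _ _ _ t ∧ @LocallyConvexSpace ℝ _ _ _ _ _ t ∧
    ∀ S : Set (smoothBdd n), IsBddSubset S →
      TopologicalSpace.induced (Subtype.val : S → smoothBdd n) t =
        TopologicalSpace.induced (Subtype.val : S → smoothBdd n) (smoothTopology n)

/-- The topology of `𝓑_c`: the finest locally convex topology on `𝓑` that induces on the bounded
subsets of `𝓑` the topology inherited from `C^∞(ℝⁿ)`. (In Mathlib's order on topologies smaller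
means finer.) -/
abbrev bcTopology (n : ℕ) : TopologicalSpace (smoothBdd n) :=
  sInf {t | IsAdmissibleTopology t}

/-- A Schwartz function as an element of `𝓑̇`. -/
def schwartzToVanishing {n : ℕ} (φ : 𝓢(Rn n, ℂ)) : smoothVanishing n :=
  ⟨φ, φ.smooth', fun k => by
    obtain ⟨C, hC⟩ := φ.decay 1 k
    have hlim : Tendsto (fun x : Rn n => C * ‖x‖⁻¹) (cocompact (Rn n)) (𝓝 0) := by
      simpa using (tendsto_inv_atTop_zero.comp (tendsto_norm_cocompact_atTop (E := Rn n))).const_mul C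
    refine squeeze_zero_norm' ?_ hlim
    filter_upwards [(tendsto_norm_cocompact_atTop (E := Rn n)).eventually_gt_atTop 0] with x hx
    rw [← div_eq_mul_inv, le_div_iff₀ hx, mul_comm]
    simpa using hC.2 x⟩

/-- A Schwartz function as an element of `𝓑`. -/
def schwartzToBdd {n : ℕ} (φ : 𝓢(Rn n, ℂ)) : smoothBdd n :=
  ⟨φ, φ.smooth', fun k => by
    obtain ⟨C, hC⟩ := φ.decay 0 k
    exact ⟨C, fun x => by simpa using hC.2 x⟩⟩

/-- The constant function `1` as an element of `𝓑`. -/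
def oneBdd (n : ℕ) : smoothBdd n :=
  ⟨fun _ => 1, contDiff_const, fun k => by
    rcases Nat.eq_zero_or_pos k with rfl | hk
    · exact ⟨1, fun x => by simp⟩
    · refine ⟨0, fun x => ?_⟩
      simp [iteratedFDeriv_const_of_ne (𝕜 := ℝ) hk.ne' (1 : ℂ)]⟩

/-! ### Integrable distributions and their weighted versions -/

/-- `u ∈ 𝓓'_{L¹}`: the tempered distribution `u` is the restriction to Schwartz functions of an
element of the dual of `𝓑̇`. -/
def IsIntegrableDistribution {n : ℕ} (u : 𝓢'(Rn n, ℂ)) : Prop :=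
  ∃ T : smoothVanishing n →ₗ[ℂ] ℂ, @Continuous _ _ (vanishingTopology n) _ T ∧
    ∀ φ : 𝓢(Rn n, ℂ), T (schwartzToVanishing φ) = u φ

/-- `⟨u, 1⟩ = c` in the duality between `𝓓'_{L¹}` and `𝓑_c`: the extension of `u` to a continuous
linear form on `𝓑_c` takes the value `c` at the constant function `1`. (The extension is unique
because the Schwartz functions are dense in `𝓑_c`.) -/
def HasIntegral {n : ℕ} (u : 𝓢'(Rn n, ℂ)) (c : ℂ) : Prop :=
  ∃ T : smoothBdd n →ₗ[ℂ] ℂ, @Continuous _ _ (bcTopology n) _ T ∧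
    (∀ φ : 𝓢(Rn n, ℂ), T (schwartzToBdd φ) = u φ) ∧ T (oneBdd n) = c

/-- The weight `w^μ`, where `w(x) = (1 + |x|²)^{1/2}`. -/
def weight {n : ℕ} (μ : ℝ) (x : Rn n) : ℝ := (1 + ‖x‖ ^ 2) ^ (μ / 2)

lemma weight_hasTemperateGrowth {n : ℕ} (μ : ℝ) :
    (fun x : Rn n => (weight μ x : ℂ)).HasTemperateGrowth := by
  have h := Function.hasTemperateGrowth_one_add_norm_sq_rpow (Rn n) (μ / 2)
  exact Function.HasTemperateGrowth.comp Function.Complex.hasTemperateGrowth_ofReal h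

/-- The space `w^μ 𝓓'_{L¹}` of tempered distributions `u` with `w^{-μ} u ∈ 𝓓'_{L¹}`. -/
def weightedIntegrable (n : ℕ) (μ : ℝ) : Set 𝓢'(Rn n, ℂ) :=
  {u | IsIntegrableDistribution
    (TemperedDistribution.smulLeftCLM ℂ (fun x : Rn n => (weight (-μ) x : ℂ)) u)}

/-! ### The `𝓢'`-convolution -/

/-- The translate `x ↦ φ (x + η)` of a Schwartz function. -/
def shift {n : ℕ} (η : Rn n) (φ : 𝓢(Rn n, ℂ)) : 𝓢(Rn n, ℂ) :=
  φ.compSubConstCLM ℂ (-η)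

@[simp] lemma shift_apply {n : ℕ} (η : Rn n) (φ : 𝓢(Rn n, ℂ)) (x : Rn n) :
    shift η φ x = φ (x + η) := by
  simp [shift]

/-- The function `v̌ ∗ φ`, that is `η ↦ ⟨v, φ(· + η)⟩`, for a tempered distribution `v` and a
Schwartz function `φ`. It is smooth and, with all its derivatives, of polynomial growth. -/
def reflConv {n : ℕ} (v : 𝓢'(Rn n, ℂ)) (φ : 𝓢(Rn n, ℂ)) : Rn n → ℂ :=
  fun η => v (shift η φ)

/-- `u` and `v` are `𝓢'`-convolvable: `u (v̌ ∗ φ) ∈ 𝓓'_{L¹}` for every Schwartz function `φ`. -/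
def SConvolvable {n : ℕ} (u v : 𝓢'(Rn n, ℂ)) : Prop :=
  ∀ φ : 𝓢(Rn n, ℂ),
    IsIntegrableDistribution (TemperedDistribution.smulLeftCLM ℂ (reflConv v φ) u)

/-- `u` and `v` are `𝓢'`-convolvable, and their `𝓢'`-convolution `φ ↦ ⟨u (v̌ ∗ φ), 1⟩` is the
tempered distribution `g`. -/
def IsSConvolution {n : ℕ} (u v g : 𝓢'(Rn n, ℂ)) : Prop :=
  SConvolvable u v ∧ ∀ φ : 𝓢(Rn n, ℂ),
    HasIntegral (TemperedDistribution.smulLeftCLM ℂ (reflConv v φ) u) (g φ)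

/-- The tempered distribution `g` is the function `G`, acting by integration. -/
def IsGivenBy {n : ℕ} (g : 𝓢'(Rn n, ℂ)) (G : Rn n → ℂ) : Prop :=
  ∀ φ : 𝓢(Rn n, ℂ), Integrable (fun x => φ x * G x) ∧ g φ = ∫ x, φ x * G x

/-! ### The kernel and the Poisson integral -/

/-- The kernel `𝒦_α(x, y)` of the half space, for `y > 0`. -/
def kernel {n : ℕ} (α : ℝ) (x : Rn n) (y : ℝ) : ℝ :=
  Real.Gamma ((α + n + 1) / 2) / (Real.Gamma ((α + 1) / 2) * Real.pi ^ ((n : ℝ) / 2)) *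
    (y ^ (α + 1) / (‖x‖ ^ 2 + y ^ 2) ^ ((α + n + 1) / 2))

lemma kernel_hasTemperateGrowth {n : ℕ} (α : ℝ) {y : ℝ} (hy : 0 < y) :
    (fun x : Rn n => (kernel α x y : ℂ)).HasTemperateGrowth := by
  have h := Function.hasTemperateGrowth_one_add_norm_sq_rpow (Rn n) (-((α + n + 1) / 2))
  have hl : (fun x : Rn n => y⁻¹ • x).HasTemperateGrowth := by fun_prop
  have h2 := h.comp hl
  refine Function.HasTemperateGrowth.comp Function.Complex.hasTemperateGrowth_ofReal
    (f := fun x : Rn n => kernel α x y) ?_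
  have h3 := (Function.HasTemperateGrowth.const (E := Rn n)
    (Real.Gamma ((α + n + 1) / 2) / (Real.Gamma ((α + 1) / 2) * Real.pi ^ ((n : ℝ) / 2)) *
      (y ^ (α + 1) * (y ^ 2) ^ (-((α + n + 1) / 2))))).mul h2
  refine Eq.mp (congrArg Function.HasTemperateGrowth ?_) h3
  funext x
  have e : ‖x‖ ^ 2 + y ^ 2 = y ^ 2 * (1 + ‖y⁻¹ • x‖ ^ 2) := by
    rw [norm_smul, norm_inv, Real.norm_of_nonneg hy.le]
    field_simp
    ring
  simp only [kernel, Pi.mul_apply, Function.comp]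
  rw [e, Real.mul_rpow (by positivity) (by positivity), Real.rpow_neg (by positivity),
    Real.rpow_neg (by positivity)]
  field_simp

/-- The function `𝒦_{α,y} = 𝒦_α(·, y)` as a tempered distribution. -/
def kernelDistribution {n : ℕ} (α : ℝ) {y : ℝ} (hy : 0 < y) : 𝓢'(Rn n, ℂ) :=
  Function.HasTemperateGrowth.toTemperedDistribution volume
    (kernel_hasTemperateGrowth (n := n) α hy)

/-- `F` is (on the half space `y > 0`) the Poisson integral of `f`: for every `y > 0`, the
`𝓢'`-convolution of `f` and `𝒦_{α,y}` exists and is the continuous function `F(·, y)`. -/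
def IsPoissonIntegral {n : ℕ} (α : ℝ) (f : 𝓢'(Rn n, ℂ)) (F : Rn n → ℝ → ℂ) : Prop :=
  ∀ (y : ℝ) (hy : 0 < y), Continuous (fun x => F x y) ∧
    ∃ g : 𝓢'(Rn n, ℂ), IsSConvolution f (kernelDistribution α hy) g ∧
      IsGivenBy g (fun x => F x y)

/-- The values of `|F(x, y) cos^k ϑ|` for `(x, y)` in the hemisphere
`S_r = {y > 0, |x|² + y² = r²}`, where `ϑ ∈ [0, π/2)`, `y = r cos ϑ` and `|x| = r sin ϑ`. -/
def hemisphereValues {n : ℕ} (F : Rn n → ℝ → ℂ) (k : ℕ) (r : ℝ) : Set ℝ :=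
  {s | ∃ (x : Rn n) (y θ : ℝ), 0 < y ∧ ‖x‖ ^ 2 + y ^ 2 = r ^ 2 ∧
    0 ≤ θ ∧ θ < Real.pi / 2 ∧ y = r * Real.cos θ ∧ ‖x‖ = r * Real.sin θ ∧
    s = ‖F x y * (Real.cos θ : ℂ) ^ k‖}

end PoissonGrowth

end

noncomputable section

namespace PoissonGrowth

/-! ### Derivatives of powers of `|x|² + y²` -/

/-! Put μ = α+n+1. A continuous functional on 𝓑̇ is bounded by finitely many sup norms of
derivatives, and this forces it to be small on test functions supported far out, as for a finite
measure. Hence w^{-μ} f extends to a tight form U on 𝓑 (`exists_isTight_extension`), which is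
continuous on 𝓑_c. The Poisson integral is F(x,y) = U(w^μ 𝒦_α(· - x, y)): superposing these test
functions against φ ∈ 𝓢 gives w^μ times the reflected convolution, and U commutes with the
superposition (`exists_superposition`, `isPoissonIntegral_poissonValue`).

For the growth on |x|² + y² = r², the test function is cut in two by a cutoff in η. At height y ≥ 1
(`exists_bound_of_one_le`) the cutoff radius R is fixed. Near the origin the kernel has size about
y^{α+1} r^{-μ}, which gives O(1). Far out, the test function and its derivatives are O(r^{α+1}
(r/y)^n), and tightness supplies a factor ε; cos^n ϑ = (y/r)^n removes the last factor.

At height y < 1 (`exists_bound_of_lt_one`) each derivative of the kernel may cost 1/y, and the order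
N of U may depend on α. The cutoff radius is therefore 2r: the outer part is harmless since η stays
away from x, while on the inner part U is f itself, whose Schwartz order m does not depend on α.
That part is O(r^m y^{-(n+m)}), so cos^{n+m} ϑ makes it bounded, and bounded is o(r^{α+1}) because α
> -1. -/

lemma contDiff_norm_sq_add_rpow {n : ℕ} (s : ℝ) {y : ℝ} (hy : 0 < y) :
    ContDiff ℝ ∞ (fun ξ : Rn n => (‖ξ‖ ^ 2 + y ^ 2) ^ s) :=
  ((contDiff_norm_sq ℝ).add contDiff_const).rpow_const_of_ne fun x => by positivity

lemma fderiv_norm_sq_add_rpow {n : ℕ} (s : ℝ) {y : ℝ} (hy : 0 < y) :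
    fderiv ℝ (fun ξ : Rn n => (‖ξ‖ ^ 2 + y ^ 2) ^ (s / 2)) =
      fun ξ => (‖ξ‖ ^ 2 + y ^ 2) ^ ((s - 2) / 2) • (s • innerSL ℝ ξ) := by
  funext ξ
  have h := ((hasStrictFDerivAt_norm_sq ξ).hasFDerivAt.add_const (y ^ 2)).rpow_const (p := s / 2)
    (Or.inl (by positivity))
  rw [h.fderiv]
  ext v
  simp only [_root_.smul_apply, smul_eq_mul, nsmul_eq_mul]
  rw [show (s - 2) / 2 = s / 2 - 1 by ring]
  simp
  ring

lemma norm_iteratedFDeriv_innerSL_le {n : ℕ} (k : ℕ) (ξ : Rn n) :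
    ‖iteratedFDeriv ℝ k (fun x : Rn n => innerSL ℝ x) ξ‖ ≤ if k = 0 then ‖ξ‖ else
      if k = 1 then 1 else 0 := by
  rcases k with _ | _ | k
  · simp
  · rw [zero_add, norm_iteratedFDeriv_one]
    have : fderiv ℝ (fun x : Rn n => innerSL ℝ x) ξ = (innerSL ℝ : Rn n →L[ℝ] _) :=
      (innerSL ℝ : Rn n →L[ℝ] _).fderiv
    rw [this]
    simpa using norm_innerSL_le (𝕜 := ℝ) (E := Rn n)
  · have : fderiv ℝ (fun x : Rn n => innerSL ℝ x) = fun _ => (innerSL ℝ : Rn n →L[ℝ] _) := by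
      funext x
      exact (innerSL ℝ : Rn n →L[ℝ] _).fderiv
    rw [← norm_iteratedFDeriv_fderiv, this, iteratedFDeriv_const_of_ne (by simp)]
    simp

/-- The symbol estimates for `(|x|² + y²)^{s/2}`, uniform in `y > 0`. -/
lemma norm_iteratedFDeriv_norm_sq_add_rpow_le (n j : ℕ) (s : ℝ) :
    ∃ C : ℝ, 0 ≤ C ∧ ∀ y : ℝ, 0 < y → ∀ ξ : Rn n,
      ‖iteratedFDeriv ℝ j (fun ξ : Rn n => (‖ξ‖ ^ 2 + y ^ 2) ^ (s / 2)) ξ‖ ≤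
        C * (‖ξ‖ ^ 2 + y ^ 2) ^ ((s - j) / 2) := by
  induction j using Nat.strong_induction_on generalizing s with
  | _ j ih =>
  rcases j with _ | j
  · refine ⟨1, zero_le_one, fun y hy ξ => ?_⟩
    simp only [norm_iteratedFDeriv_zero, Nat.cast_zero, sub_zero, one_mul]
    rw [Real.norm_of_nonneg (by positivity)]
  -- One differentiation turns the exponent s into s - 2 times a linear factor, so the induction
  -- must cover all s. The default value 0 for i > j only serves to choose the constants for all i
  -- at once.
  · have ih' : ∀ i : ℕ, ∃ C : ℝ, 0 ≤ C ∧ (i ≤ j → ∀ y : ℝ, 0 < y → ∀ ξ : Rn n,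
        ‖iteratedFDeriv ℝ i (fun ξ : Rn n => (‖ξ‖ ^ 2 + y ^ 2) ^ ((s - 2) / 2)) ξ‖ ≤
        C * (‖ξ‖ ^ 2 + y ^ 2) ^ ((s - 2 - i) / 2)) := by
      intro i
      by_cases hi : i ≤ j
      · obtain ⟨C, hC, h⟩ := ih i (by lia) (s - 2)
        exact ⟨C, hC, fun _ => h⟩
      · exact ⟨0, le_rfl, fun h => absurd h hi⟩
    choose C hC h using ih'
    refine ⟨∑ i ∈ Finset.range (j + 1), (j.choose i : ℝ) * C i * |s|,
      Finset.sum_nonneg fun i _ => by have := hC i; positivity, fun y hy ξ => ?_⟩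
    rw [← norm_iteratedFDeriv_fderiv, fderiv_norm_sq_add_rpow s hy]
    have hlin : ContDiff ℝ ∞ (fun x : Rn n => s • innerSL ℝ x) :=
      (innerSL ℝ : Rn n →L[ℝ] _).contDiff.const_smul s
    refine (norm_iteratedFDeriv_smul_le (N := ∞) (contDiff_norm_sq_add_rpow _ hy) hlin ξ
      (n := j) (mod_cast le_top)).trans ?_
    rw [Finset.sum_mul]
    refine Finset.sum_le_sum fun i hi => ?_
    have hij : i ≤ j := by simpa [Nat.lt_succ_iff] using hi
    have h1 := h i hij y hy ξ
    set q : ℝ := ‖ξ‖ ^ 2 + y ^ 2 with hq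
    have hq0 : 0 < q := by positivity
    have h2 : ‖iteratedFDeriv ℝ (j - i) (fun x : Rn n => s • innerSL ℝ x) ξ‖ ≤
        |s| * q ^ ((1 - ((j : ℝ) - i)) / 2) := by
      rw [iteratedFDeriv_const_smul_apply' (i := (j - i : ℕ))
        ((innerSL ℝ : Rn n →L[ℝ] _).contDiff.contDiffAt), norm_smul, Real.norm_eq_abs]
      refine mul_le_mul_of_nonneg_left
        ((norm_iteratedFDeriv_innerSL_le (j - i) ξ).trans ?_) (abs_nonneg s)
      -- The linear factor is at most √q, its first derivative is constant, and all later ones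
      -- vanish; each case matches the exponent (1 - (j - i))/2 or is trivially below it.
      split_ifs with h3 h3
      · have : j = i := by lia
        subst this
        rw [sub_self, sub_zero, ← Real.sqrt_eq_rpow]
        exact Real.le_sqrt_of_sq_le (by rw [hq]; nlinarith [sq_nonneg y])
      · have : j = i + 1 := by lia
        subst this
        simp
      · positivity
    calc _ ≤ (j.choose i : ℝ) * (C i * q ^ ((s - 2 - i) / 2)) *
          (|s| * q ^ ((1 - ((j : ℝ) - i)) / 2)) := by
          have := hC i
          gcongr
      _ = (j.choose i : ℝ) * C i * |s| * (q ^ ((s - 2 - i) / 2) *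
          q ^ ((1 - ((j : ℝ) - i)) / 2)) := by ring
      _ = _ := by
        rw [← Real.rpow_add hq0]
        congr 2
        push_cast
        ring

/-! ### Products of smooth functions -/

lemma norm_iteratedFDeriv_mul_le_of_le {n : ℕ} {N : ℕ} {φ ψ : Rn n → ℂ} (hφ : ContDiff ℝ ∞ φ)
    (hψ : ContDiff ℝ ∞ ψ) {x : Rn n} {a b : ℝ}
    (ha : ∀ k ≤ N, ‖iteratedFDeriv ℝ k φ x‖ ≤ a) (hb : ∀ k ≤ N, ‖iteratedFDeriv ℝ k ψ x‖ ≤ b)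
    {k : ℕ} (hk : k ≤ N) :
    ‖iteratedFDeriv ℝ k (fun x => φ x * ψ x) x‖ ≤ 2 ^ N * (a * b) := by
  have ha0 : 0 ≤ a := (norm_nonneg _).trans (ha 0 (Nat.zero_le _))
  have hb0 : 0 ≤ b := (norm_nonneg _).trans (hb 0 (Nat.zero_le _))
  calc _ ≤ ∑ i ∈ Finset.range (k + 1), (k.choose i : ℝ) * ‖iteratedFDeriv ℝ i φ x‖ *
        ‖iteratedFDeriv ℝ (k - i) ψ x‖ :=
        norm_iteratedFDeriv_mul_le hφ hψ x (mod_cast le_top)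
    _ ≤ ∑ i ∈ Finset.range (k + 1), (k.choose i : ℝ) * (a * b) := by
        refine Finset.sum_le_sum fun i hi => ?_
        have : i ≤ k := by simpa [Nat.lt_succ_iff] using hi
        rw [mul_assoc]
        gcongr
        · exact ha i (by lia)
        · exact hb (k - i) (by lia)
    _ = 2 ^ k * (a * b) := by
        rw [← Finset.sum_mul]
        congr 1
        exact_mod_cast Nat.sum_range_choose k
    _ ≤ _ := by
        gcongr
        norm_num

lemma norm_iteratedFDeriv_ofReal {n : ℕ} {f : Rn n → ℝ} (hf : ContDiff ℝ ∞ f) (k : ℕ) (x : Rn n) :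
    ‖iteratedFDeriv ℝ k (fun x => (f x : ℂ)) x‖ = ‖iteratedFDeriv ℝ k f x‖ :=
  Complex.ofRealLI.norm_iteratedFDeriv_comp_left hf.contDiffAt (mod_cast le_top)

/-- All derivatives of `ψ` of order at most `N` are bounded by `c`. -/
def DerivBound {n : ℕ} (N : ℕ) (c : ℝ) (ψ : Rn n → ℂ) : Prop :=
  ∀ k ≤ N, ∀ x, ‖iteratedFDeriv ℝ k ψ x‖ ≤ c

lemma DerivBound.nonneg {n N : ℕ} {c : ℝ} {ψ : Rn n → ℂ} (h : DerivBound N c ψ) : 0 ≤ c :=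
  (norm_nonneg _).trans (h 0 (Nat.zero_le _) 0)

lemma DerivBound.mono {n N : ℕ} {c d : ℝ} {ψ : Rn n → ℂ} (h : DerivBound N c ψ) (hcd : c ≤ d) :
    DerivBound N d ψ := fun k hk x => (h k hk x).trans hcd

lemma DerivBound.mul {n N : ℕ} {c d : ℝ} {φ ψ : Rn n → ℂ} (hφ : ContDiff ℝ ∞ φ)
    (hψ : ContDiff ℝ ∞ ψ) (h : DerivBound N c φ) (h' : DerivBound N d ψ) :
    DerivBound N (2 ^ N * (c * d)) (fun x => φ x * ψ x) := fun _ hk x =>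
  norm_iteratedFDeriv_mul_le_of_le hφ hψ (fun k hk => h k hk x) (fun k hk => h' k hk x) hk

lemma DerivBound.add {n N : ℕ} {c d : ℝ} {φ ψ : Rn n → ℂ} (hφ : ContDiff ℝ ∞ φ)
    (hψ : ContDiff ℝ ∞ ψ) (h : DerivBound N c φ) (h' : DerivBound N d ψ) :
    DerivBound N (c + d) (φ + ψ) := fun k hk x => by
  rw [iteratedFDeriv_add_apply (hφ.contDiffAt.of_le (mod_cast le_top))
      (hψ.contDiffAt.of_le (mod_cast le_top))]
  exact (norm_add_le _ _).trans (add_le_add (h k hk x) (h' k hk x))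

lemma DerivBound.const_smul {n N : ℕ} {c : ℝ} {φ : Rn n → ℂ} (hφ : ContDiff ℝ ∞ φ)
    (h : DerivBound N c φ) (a : ℂ) : DerivBound N (‖a‖ * c) (a • φ) := fun k hk x => by
  rw [iteratedFDeriv_const_smul_apply (hφ.contDiffAt.of_le (mod_cast le_top)), norm_smul]
  exact mul_le_mul_of_nonneg_left (h k hk x) (norm_nonneg a)

lemma DerivBound.sub {n N : ℕ} {c d : ℝ} {φ ψ : Rn n → ℂ} (hφ : ContDiff ℝ ∞ φ)
    (hψ : ContDiff ℝ ∞ ψ) (h : DerivBound N c φ) (h' : DerivBound N d ψ) :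
    DerivBound N (c + d) (φ - ψ) := by
  have := h.add hφ (hψ.const_smul (-1 : ℂ)) (h'.const_smul hψ (-1))
  refine Eq.mp (congrArg₂ (DerivBound N) (by simp) ?_) this
  funext x
  simp [sub_eq_add_neg]

lemma contDiff_smoothBdd {n : ℕ} (ψ : smoothBdd n) : ContDiff ℝ ∞ (ψ : Rn n → ℂ) := ψ.2.1

lemma exists_derivBound_smoothBdd {n : ℕ} (ψ : smoothBdd n) (N : ℕ) :
    ∃ c, DerivBound N c (ψ : Rn n → ℂ) := by
  choose C hC using ψ.2.2
  refine ⟨∑ k ∈ Finset.range (N + 1), C k, fun k hk x => (hC k x).trans ?_⟩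
  refine Finset.single_le_sum (f := C) (fun i _ => (norm_nonneg _).trans (hC i 0)) ?_
  simpa [Nat.lt_succ_iff] using hk

lemma mem_smoothBdd_of_derivBound {n : ℕ} {ψ : Rn n → ℂ} (hψ : ContDiff ℝ ∞ ψ)
    (h : ∀ N, ∃ c, DerivBound N c ψ) : ψ ∈ smoothBdd n :=
  ⟨hψ, fun k => let ⟨c, hc⟩ := h k; ⟨c, fun x => hc k le_rfl x⟩⟩

/-- The product of two elements of `𝓑`. -/
def mulBdd {n : ℕ} (b ψ : smoothBdd n) : smoothBdd n :=
  ⟨fun x => (b : Rn n → ℂ) x * (ψ : Rn n → ℂ) x,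
    mem_smoothBdd_of_derivBound ((contDiff_smoothBdd b).mul (contDiff_smoothBdd ψ)) fun N => by
      obtain ⟨c, hc⟩ := exists_derivBound_smoothBdd b N
      obtain ⟨d, hd⟩ := exists_derivBound_smoothBdd ψ N
      exact ⟨_, hc.mul (contDiff_smoothBdd b) (contDiff_smoothBdd ψ) hd⟩⟩

@[simp] lemma mulBdd_apply {n : ℕ} (b ψ : smoothBdd n) (x : Rn n) :
    (mulBdd b ψ : Rn n → ℂ) x = (b : Rn n → ℂ) x * (ψ : Rn n → ℂ) x := rfl

/-- Multiplication by an element of `𝓑`. -/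
def mulBddLM {n : ℕ} (b : smoothBdd n) : smoothBdd n →ₗ[ℂ] smoothBdd n where
  toFun := mulBdd b
  map_add' φ ψ := Subtype.ext (funext fun x => by simp [mul_add])
  map_smul' c ψ := Subtype.ext (funext fun x => by simp [mul_left_comm])

@[simp] lemma mulBddLM_apply {n : ℕ} (b ψ : smoothBdd n) : mulBddLM b ψ = mulBdd b ψ := rfl

/-! ### Cutoff functions -/

/-- A fixed bump function, equal to `1` on the unit ball and supported in the ball of radius `2`. -/
def bump (n : ℕ) : ContDiffBump (0 : Rn n) := ⟨1, 2, one_pos, one_lt_two⟩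

/-- The cutoff function `x ↦ χ(x / R)`. -/
def cutoff {n : ℕ} (R : ℝ) (x : Rn n) : ℂ := (bump n (R⁻¹ • x) : ℂ)

lemma contDiff_cutoff {n : ℕ} (R : ℝ) : ContDiff ℝ ∞ (cutoff (n := n) R) :=
  Complex.ofRealCLM.contDiff.comp ((bump n).contDiff.comp (contDiff_const_smul _))

lemma cutoff_eq_one {n : ℕ} {R : ℝ} (hR : 0 < R) {x : Rn n} (hx : ‖x‖ ≤ R) : cutoff R x = 1 := by
  have : bump n (R⁻¹ • x) = 1 := by
    refine (bump n).one_of_mem_closedBall ?_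
    rw [mem_closedBall_zero_iff, norm_smul, norm_inv, Real.norm_of_nonneg hR.le,
      inv_mul_le_iff₀ hR]
    simpa [bump] using hx
  simp [cutoff, this]

lemma cutoff_eq_zero {n : ℕ} {R : ℝ} (hR : 0 < R) {x : Rn n} (hx : 2 * R ≤ ‖x‖) :
    cutoff R x = 0 := by
  have : bump n (R⁻¹ • x) = 0 := by
    refine (bump n).zero_of_le_dist ?_
    rw [dist_zero_right, norm_smul, norm_inv, Real.norm_of_nonneg hR.le, le_inv_mul_iff₀ hR]
    simpa [bump, mul_comm] using hx
  simp [cutoff, this]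

lemma hasCompactSupport_cutoff {n : ℕ} {R : ℝ} (hR : 0 < R) :
    HasCompactSupport (cutoff (n := n) R) :=
  HasCompactSupport.of_support_subset_isCompact (isCompact_closedBall (0 : Rn n) (2 * R))
    fun x hx => by
      by_contra h
      exact hx (cutoff_eq_zero hR (by simpa using (not_le.1 (by simpa using h)).le))

lemma exists_derivBound_cutoff (n N : ℕ) :
    ∃ C : ℝ, 0 ≤ C ∧ ∀ R : ℝ, 1 ≤ R → DerivBound N C (cutoff (n := n) R) := by
  have h1 : HasCompactSupport (cutoff (n := n) 1) := hasCompactSupport_cutoff one_pos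
  have h2 : ∀ k : ℕ, ∃ C : ℝ, ∀ x, ‖iteratedFDeriv ℝ k (cutoff (n := n) 1) x‖ ≤ C := fun k =>
    (h1.iteratedFDeriv k).exists_bound_of_continuous
      ((contDiff_cutoff 1).continuous_iteratedFDeriv (mod_cast le_top))
  obtain ⟨C, hC⟩ := exists_derivBound_smoothBdd ⟨_, contDiff_cutoff (n := n) 1, h2⟩ N
  refine ⟨C, hC.nonneg, fun R hR k hk x => ?_⟩
  have : cutoff (n := n) R = fun x => cutoff 1 (R⁻¹ • x) := by
    funext x
    simp [cutoff]
  rw [this, iteratedFDeriv_comp_const_smul _ ((contDiff_cutoff 1).of_le (mod_cast le_top)),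
    norm_smul]
  have h3 : ‖R⁻¹ ^ k‖ ≤ 1 := by
    rw [norm_pow, norm_inv, Real.norm_of_nonneg (by linarith)]
    exact pow_le_one₀ (by positivity) (inv_le_one_of_one_le₀ hR)
  calc _ ≤ 1 * C := mul_le_mul h3 (hC k hk _) (norm_nonneg _) zero_le_one
    _ = C := one_mul C

lemma exists_derivBound_one_sub_cutoff (n N : ℕ) :
    ∃ C : ℝ, 0 ≤ C ∧ ∀ R : ℝ, 1 ≤ R → DerivBound N C (fun x : Rn n => 1 - cutoff R x) := by
  obtain ⟨C, hC, h⟩ := exists_derivBound_cutoff n N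
  obtain ⟨D, hD⟩ := exists_derivBound_smoothBdd (oneBdd n) N
  have hD0 := hD.nonneg
  refine ⟨D + ‖(-1 : ℂ)‖ * C, by positivity, fun R hR => ?_⟩
  have h2 := hD.add (contDiff_smoothBdd (oneBdd n)) ((contDiff_cutoff R).const_smul (-1 : ℂ))
    ((h R hR).const_smul (contDiff_cutoff R) (-1))
  refine Eq.mp (congrArg (DerivBound N _) ?_) h2
  funext x
  simp [oneBdd, sub_eq_add_neg]

lemma iteratedFDeriv_eq_zero_of_norm_lt {n : ℕ} {R : ℝ} {ψ : Rn n → ℂ}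
    (h : ∀ x, ‖x‖ < R → ψ x = 0) (k : ℕ) {x : Rn n} (hx : ‖x‖ < R) :
    iteratedFDeriv ℝ k ψ x = 0 := by
  have h1 : ψ =ᶠ[𝓝 x] fun _ => 0 := by
    filter_upwards [continuous_norm.continuousAt.eventually_lt_const hx] with z hz using h z hz
  rw [(h1.iteratedFDeriv ℝ k).eq_of_nhds, iteratedFDeriv_fun_zero]
  rfl

lemma derivBound_cutoff_mul {n N : ℕ} {R K b : ℝ} (hR : 0 < R)
    (hK : DerivBound N K (cutoff (n := n) R)) {ψ : Rn n → ℂ} (hψ : ContDiff ℝ ∞ ψ)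
    (h : ∀ k ≤ N, ∀ x, ‖x‖ ≤ 2 * R → ‖iteratedFDeriv ℝ k ψ x‖ ≤ b) :
    DerivBound N (2 ^ N * (K * b)) (fun x => cutoff R x * ψ x) := by
  intro k hk x
  have hK0 := hK.nonneg
  have hb0 : 0 ≤ b := (norm_nonneg _).trans (h 0 (Nat.zero_le _) 0 (by simpa using hR.le))
  by_cases hx : ‖x‖ ≤ 2 * R
  · exact norm_iteratedFDeriv_mul_le_of_le (contDiff_cutoff R) hψ
      (fun k hk => hK k hk x) (fun k hk => h k hk x hx) hk
  · have h1 : (fun x => cutoff R x * ψ x) =ᶠ[𝓝 x] fun _ => 0 := by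
      filter_upwards [continuous_norm.continuousAt.eventually_const_lt (not_le.1 hx)] with z hz
      rw [cutoff_eq_zero hR hz.le, zero_mul]
    rw [(h1.iteratedFDeriv ℝ k).eq_of_nhds, iteratedFDeriv_fun_zero]
    simp only [Pi.zero_apply, norm_zero]
    positivity

lemma derivBound_one_sub_cutoff_mul {n N : ℕ} {R L b : ℝ} (hR : 0 < R)
    (hL : DerivBound N L (fun x : Rn n => 1 - cutoff R x)) {ψ : Rn n → ℂ} (hψ : ContDiff ℝ ∞ ψ)
    (hb0 : 0 ≤ b) (h : ∀ k ≤ N, ∀ x, R ≤ ‖x‖ → ‖iteratedFDeriv ℝ k ψ x‖ ≤ b) :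
    DerivBound N (2 ^ N * (L * b)) (fun x => (1 - cutoff R x) * ψ x) := by
  intro k hk x
  have hL0 := hL.nonneg
  by_cases hx : ‖x‖ < R
  · rw [iteratedFDeriv_eq_zero_of_norm_lt (R := R) (fun x hx => by
      rw [cutoff_eq_one hR hx.le, sub_self, zero_mul]) k hx, norm_zero]
    positivity
  · exact norm_iteratedFDeriv_mul_le_of_le (contDiff_const.sub (contDiff_cutoff _)) hψ
      (fun k hk => hL k hk x) (fun k hk => h k hk x (not_lt.1 hx)) hk

/-- The cutoff function as an element of `𝓑`. -/
def cutoffBdd {n : ℕ} (R : ℝ) (hR : 1 ≤ R) : smoothBdd n :=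
  ⟨cutoff R, mem_smoothBdd_of_derivBound (contDiff_cutoff R) fun N =>
    let ⟨C, _, h⟩ := exists_derivBound_cutoff n N; ⟨C, h R hR⟩⟩

/-! ### Tightness of integrable distributions -/

/-- A neighbourhood of 0 in the product topology constrains only finitely many derivatives; the rest
is homogeneity. -/
lemma exists_bound_of_continuous_vanishing {n : ℕ} (T : smoothVanishing n →ₗ[ℂ] ℂ)
    (hT : @Continuous _ _ (vanishingTopology n) _ T) :
    ∃ (N : ℕ) (C : ℝ), 0 ≤ C ∧ ∀ (φ : smoothVanishing n) (c : ℝ),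
      DerivBound N c (φ : Rn n → ℂ) → ‖T φ‖ ≤ C * c := by
  obtain ⟨N, ε, hε, h⟩ : ∃ (N : ℕ) (ε : ℝ), 0 < ε ∧ ∀ φ : smoothVanishing n,
      DerivBound N ε (φ : Rn n → ℂ) → ‖T φ‖ < 1 := by
    have h0 : {φ | ‖T φ‖ < 1} ∈ @nhds _ (vanishingTopology n) 0 := by
      have : Tendsto T (@nhds _ (vanishingTopology n) 0) (𝓝 0) := by
        have := @Continuous.tendsto _ _ (vanishingTopology n) _ _ hT 0
        rwa [map_zero] at this
      have h1 := this.norm.eventually_lt_const (show ‖(0 : ℂ)‖ < 1 by simp)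
      exact h1
    rw [nhds_induced, mem_comap] at h0
    obtain ⟨V, hV, hVT⟩ := h0
    rw [nhds_pi, Filter.mem_pi] at hV
    obtain ⟨I, hI, t, ht, hIt⟩ := hV
    have hk : ∀ k : ℕ, ∃ ε : ℝ, 0 < ε ∧ ∀ φ : smoothVanishing n,
        (∀ x, ‖iteratedFDeriv ℝ k (φ : Rn n → ℂ) x‖ ≤ ε) →
          UniformFun.ofFun (iteratedFDeriv ℝ k (φ : Rn n → ℂ)) ∈ t k := by
      intro k
      obtain ⟨ε, hε, h⟩ := ((UniformFun.hasBasis_nhds_of_basis (Rn n) (Rn n [×k]→L[ℝ] ℂ) _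
        Metric.uniformity_basis_dist).mem_iff).1 (ht k)
      refine ⟨ε / 2, by positivity, fun φ hφ => h fun x => ?_⟩
      have h0 : iteratedFDeriv ℝ k ((0 : smoothVanishing n) : Rn n → ℂ) x = 0 := by
        rw [show ((0 : smoothVanishing n) : Rn n → ℂ) = fun _ => 0 from rfl,
          iteratedFDeriv_fun_zero]
        rfl
      change dist (iteratedFDeriv ℝ k ((0 : smoothVanishing n) : Rn n → ℂ) x)
        (iteratedFDeriv ℝ k (φ : Rn n → ℂ) x) < ε
      rw [h0, dist_zero_left]
      exact (hφ x).trans_lt (by linarith)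
    choose ε hε h using hk
    obtain ⟨N, hN⟩ := hI.bddAbove
    obtain ⟨k0, hk0, hmin⟩ := Finset.exists_min_image (Finset.range (N + 1)) ε ⟨0, by simp⟩
    refine ⟨N, ε k0, hε k0, fun φ hφ => hVT (hIt fun k hk => ?_)⟩
    exact h k φ fun x => (hφ k (hN hk) x).trans (hmin k (by simpa [Nat.lt_succ_iff] using hN hk))
  refine ⟨N, ε⁻¹, by positivity, fun φ c hφ => le_of_forall_pos_le_add fun δ hδ => ?_⟩
  have hc := hφ.nonneg
  -- The extra ε * δ keeps the scaling factor ε / (c + ε * δ) meaningful when c = 0.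
  have hcd : 0 < c + ε * δ := by positivity
  have h1 := h (((ε / (c + ε * δ) : ℝ) : ℂ) • φ) ((hφ.const_smul φ.2.1 _).mono (by
    rw [Complex.norm_real, Real.norm_of_nonneg (by positivity), div_mul_eq_mul_div,
      div_le_iff₀ hcd]
    nlinarith [mul_pos hε hδ]))
  rw [map_smul, norm_smul, Complex.norm_real, Real.norm_of_nonneg (by positivity),
    div_mul_eq_mul_div, div_lt_one hcd] at h1
  rw [← mul_le_mul_iff_right₀ hε]
  field_simp
  linarith

/-- Rotating b into the direction of a gives equality in the triangle inequality. It lets the values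
of a functional on two disjointly supported test functions add up. -/
lemma exists_norm_eq_one_norm_add (a b : ℂ) : ∃ ζ : ℂ, ‖ζ‖ = 1 ∧ ‖a + ζ * b‖ = ‖a‖ + ‖b‖ := by
  refine ⟨Complex.exp ((Complex.arg a - Complex.arg b : ℝ) * Complex.I),
    Complex.norm_exp_ofReal_mul_I _, ?_⟩
  have h : a + Complex.exp ((Complex.arg a - Complex.arg b : ℝ) * Complex.I) * b =
      ((‖a‖ + ‖b‖ : ℝ) : ℂ) * Complex.exp (Complex.arg a * Complex.I) := by
    have e : Complex.exp (Complex.arg a * Complex.I) =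
        Complex.exp ((Complex.arg a - Complex.arg b : ℝ) * Complex.I) *
          Complex.exp (Complex.arg b * Complex.I) := by
      rw [← Complex.exp_add]
      congr 1
      push_cast
      ring
    have ha := Complex.norm_mul_exp_arg_mul_I a
    have hb := Complex.norm_mul_exp_arg_mul_I b
    rw [Complex.ofReal_add]
    linear_combination -ha - Complex.exp ((Complex.arg a - Complex.arg b : ℝ) * Complex.I) * hb -
      (‖b‖ : ℂ) * e
  rw [h, norm_mul, Complex.norm_exp_ofReal_mul_I, mul_one, Complex.norm_real,
    Real.norm_of_nonneg (by positivity)]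

/-- A functional bounded by finitely many uniform norms of derivatives is small on test functions
supported far away. -/
lemma exists_tail_bound {n N : ℕ} {C : ℝ} (u : 𝓢'(Rn n, ℂ))
    (hu : ∀ (φ : 𝓢(Rn n, ℂ)) (c : ℝ), DerivBound N c φ → ‖u φ‖ ≤ C * c) {ε : ℝ} (hε : 0 < ε) :
    ∃ R : ℝ, ∀ (φ : 𝓢(Rn n, ℂ)) (c : ℝ), HasCompactSupport φ → (∀ x, ‖x‖ < R → φ x = 0) →
      DerivBound N c φ → ‖u φ‖ ≤ ε * c := by
  -- A near-maximizer φ₀ of |u| over the unit ball already uses the supremum up to ε. A far-away φ,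
  -- suitably rotated, can be added to φ₀ without leaving the unit ball, so |u φ| ≤ ε.
  set S : Set ℝ := {s | ∃ φ : 𝓢(Rn n, ℂ), HasCompactSupport φ ∧ DerivBound N 1 φ ∧ s = ‖u φ‖}
  have hS0 : S.Nonempty := by
    refine ⟨_, 0, ?_, fun k _ x => ?_, rfl⟩
    · exact HasCompactSupport.zero
    · rw [show ((0 : 𝓢(Rn n, ℂ)) : Rn n → ℂ) = fun _ => 0 from rfl, iteratedFDeriv_fun_zero]
      simp
  have hSb : BddAbove S := ⟨C * 1, by
    rintro _ ⟨φ, _, hφ, rfl⟩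
    exact hu φ 1 hφ⟩
  obtain ⟨_, ⟨φ₀, hφc, hφ₀, rfl⟩, hlt⟩ := exists_lt_of_lt_csSup hS0 (sub_lt_self (sSup S) hε)
  obtain ⟨R, hR⟩ := hφc.isCompact.isBounded.exists_norm_le
  -- The margin 1 beyond the support of φ₀ ensures that at every point the derivatives of φ₀ or
  -- those of φ vanish.
  have key : ∀ φ : 𝓢(Rn n, ℂ), HasCompactSupport φ → (∀ x, ‖x‖ < R + 1 → φ x = 0) →
      DerivBound N 1 φ → ‖u φ‖ ≤ ε := by
    intro φ hc h0 hb
    obtain ⟨ζ, hζ, hζ'⟩ := exists_norm_eq_one_norm_add (u φ₀) (u φ)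
    have hmem : ‖u φ₀‖ + ‖u φ‖ ∈ S := by
      refine ⟨φ₀ + ζ • φ, ?_, fun k hk x => ?_, by rw [map_add, map_smul, smul_eq_mul, hζ']⟩
      · exact HasCompactSupport.add hφc (hc.smul_left (f := fun _ => ζ))
      · have hζφ : ContDiffAt ℝ k (ζ • (φ : Rn n → ℂ)) x :=
          (ContDiff.const_smul (f := (φ : Rn n → ℂ)) ζ (φ.smooth ⊤)).contDiffAt.of_le
            (mod_cast le_top)
        rw [show ((φ₀ + ζ • φ : 𝓢(Rn n, ℂ)) : Rn n → ℂ) = (φ₀ : Rn n → ℂ) + ζ • (φ : Rn n → ℂ)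
          from rfl, iteratedFDeriv_add_apply (φ₀.contDiffAt ⊤ |>.of_le (mod_cast le_top))
          hζφ,
          iteratedFDeriv_const_smul_apply (φ.contDiffAt ⊤ |>.of_le (mod_cast le_top))]
        by_cases hx : ‖x‖ < R + 1
        · rw [iteratedFDeriv_eq_zero_of_norm_lt h0 k hx, smul_zero, add_zero]
          exact hφ₀ k hk x
        · have : iteratedFDeriv ℝ k (φ₀ : Rn n → ℂ) x = 0 := by
            by_contra h
            have := support_iteratedFDeriv_subset (𝕜 := ℝ) (f := (φ₀ : Rn n → ℂ)) k h
            linarith [hR x this]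
          rw [this, zero_add, norm_smul, hζ, one_mul]
          exact hb k hk x
    linarith [le_csSup hSb hmem]
  refine ⟨R + 1, fun φ c hc h0 hb => ?_⟩
  rcases hb.nonneg.eq_or_lt with rfl | hc0
  · have : φ = 0 := by
      ext x
      simpa using hb 0 (Nat.zero_le _) x
    simp [this]
  · have h1 := key (((c⁻¹ : ℝ) : ℂ) • φ) (hc.smul_left (f := fun _ => ((c⁻¹ : ℝ) : ℂ)))
      (fun x hx => by simp [h0 x hx])
      ((hb.const_smul (φ.smooth ⊤) _).mono (by
        rw [Complex.norm_real, Real.norm_of_nonneg (by positivity)]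
        field_simp
        exact le_rfl))
    rw [map_smul, norm_smul, Complex.norm_real, Real.norm_of_nonneg (by positivity),
      inv_mul_le_iff₀ hc0] at h1
    linarith

/-- A linear form on `𝓑` that is bounded by the uniform norms of the derivatives of order at most
`N`, with small norm on functions supported far away. -/
structure IsTight {n : ℕ} (N : ℕ) (U : smoothBdd n →ₗ[ℂ] ℂ) : Prop where
  bound : ∃ C : ℝ, 0 ≤ C ∧ ∀ (ψ : smoothBdd n) (c : ℝ), DerivBound N c (ψ : Rn n → ℂ) →
    ‖U ψ‖ ≤ C * c
  tail : ∀ ε : ℝ, 0 < ε → ∃ R : ℝ, ∀ (ψ : smoothBdd n) (c : ℝ),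
    (∀ x, ‖x‖ < R → (ψ : Rn n → ℂ) x = 0) → DerivBound N c (ψ : Rn n → ℂ) → ‖U ψ‖ ≤ ε * c

/-- The product of a cutoff function and an element of `𝓑`, as a Schwartz function. -/
def cutoffMul {n : ℕ} {R : ℝ} (hR : 0 < R) : smoothBdd n →ₗ[ℂ] 𝓢(Rn n, ℂ) where
  toFun ψ := HasCompactSupport.toSchwartzMap (f := fun x => cutoff R x * (ψ : Rn n → ℂ) x)
    (hasCompactSupport_cutoff hR).mul_right ((contDiff_cutoff R).mul (contDiff_smoothBdd ψ))
  map_add' φ ψ := by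
    ext x
    exact mul_add _ _ _
  map_smul' c ψ := by
    ext x
    exact mul_left_comm _ _ _

@[simp] lemma cutoffMul_apply {n : ℕ} {R : ℝ} (hR : 0 < R) (ψ : smoothBdd n) (x : Rn n) :
    cutoffMul hR ψ x = cutoff R x * (ψ : Rn n → ℂ) x := rfl

lemma hasCompactSupport_cutoffMul {n : ℕ} {R : ℝ} (hR : 0 < R) (ψ : smoothBdd n) :
    HasCompactSupport (cutoffMul hR ψ) :=
  (hasCompactSupport_cutoff hR).mul_right

/-- The extension of an integrable distribution to `𝓑`. -/
theorem exists_isTight_extension {n : ℕ} {u : 𝓢'(Rn n, ℂ)} (h : IsIntegrableDistribution u) :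
    ∃ (N : ℕ) (U : smoothBdd n →ₗ[ℂ] ℂ), IsTight N U ∧ ∀ φ : 𝓢(Rn n, ℂ),
      U (schwartzToBdd φ) = u φ := by
  obtain ⟨T, hT, hTu⟩ := h
  obtain ⟨N, C, hC0, hC⟩ := exists_bound_of_continuous_vanishing T hT
  have hu : ∀ (φ : 𝓢(Rn n, ℂ)) (c : ℝ), DerivBound N c φ → ‖u φ‖ ≤ C * c := fun φ c hφ => by
    rw [← hTu]
    exact hC _ _ hφ
  have htail := fun (ε : ℝ) (hε : 0 < ε) => exists_tail_bound u hu hε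
  obtain ⟨K, hK0, hK⟩ := exists_derivBound_cutoff n N
  -- Radii j + 1 rather than j: the cutoffs have uniform derivative bounds only from radius 1 on.
  have hpos : ∀ j : ℕ, (0 : ℝ) < j + 1 := fun j => by positivity
  have hone : ∀ j : ℕ, (1 : ℝ) ≤ j + 1 := fun j => by simp
  have hcut : ∀ (j : ℕ) (ψ : smoothBdd n) (c : ℝ), DerivBound N c (ψ : Rn n → ℂ) →
      DerivBound N (2 ^ N * (K * c)) (cutoffMul (hpos j) ψ) := fun j ψ c hψ =>
    (hK _ (hone j)).mul (contDiff_cutoff _) (contDiff_smoothBdd ψ) hψ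
  have hlim : ∀ ψ : smoothBdd n, ∃ a : ℂ,
      Tendsto (fun j : ℕ => u (cutoffMul (hpos j) ψ)) atTop (𝓝 a) := by
    intro ψ
    obtain ⟨c, hc⟩ := exists_derivBound_smoothBdd ψ N
    have hc0 := hc.nonneg
    -- Two cutoffs of radius beyond R agree on the ball of radius R, so their difference times ψ
    -- falls under the tail bound.
    refine cauchySeq_tendsto_of_complete (Metric.cauchySeq_iff'.2 fun ε hε => ?_)
    set D : ℝ := 2 ^ N * (K * c) + 2 ^ N * (K * c) with hD
    have hD0 : 0 ≤ D := by positivity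
    obtain ⟨R, hR⟩ := htail (ε / (D + 1)) (by positivity)
    obtain ⟨J, hJ⟩ := exists_nat_ge R
    refine ⟨J, fun j hj => ?_⟩
    have h1 := hR (cutoffMul (hpos j) ψ - cutoffMul (hpos J) ψ) D
      (HasCompactSupport.sub (hasCompactSupport_cutoffMul _ _) (hasCompactSupport_cutoffMul _ _))
      (fun x hx => by
        have : (J : ℝ) ≤ j := by exact_mod_cast hj
        rw [_root_.sub_apply, cutoffMul_apply, cutoffMul_apply,
          cutoff_eq_one (hpos j) (by linarith), cutoff_eq_one (hpos J) (by linarith), sub_self])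
      ((hcut j ψ c hc).sub ((cutoffMul (hpos j) ψ).smooth ⊤) ((cutoffMul (hpos J) ψ).smooth ⊤)
        (hcut J ψ c hc))
    rw [map_sub] at h1
    rw [dist_eq_norm]
    refine h1.trans_lt ?_
    rw [div_mul_eq_mul_div, div_lt_iff₀ (by positivity)]
    nlinarith
  choose a ha using hlim
  set U : smoothBdd n →ₗ[ℂ] ℂ := linearMapOfTendsto a
    (fun j : ℕ => (u : 𝓢(Rn n, ℂ) →ₗ[ℂ] ℂ) ∘ₗ cutoffMul (hpos j)) (tendsto_pi_nhds.2 ha) with hU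
  have hUa : ∀ ψ, U ψ = a ψ := fun ψ => rfl
  refine ⟨N, U, ⟨⟨C * (2 ^ N * K), by positivity, fun ψ c hψ => ?_⟩, fun ε hε => ?_⟩, fun φ => ?_⟩
  · rw [hUa]
    refine le_of_tendsto (ha ψ).norm (Eventually.of_forall fun j => ?_)
    refine (hu _ _ (hcut j ψ c hψ)).trans_eq (by ring)
  · obtain ⟨R, hR⟩ := htail (ε / (2 ^ N * K + 1)) (by positivity)
    refine ⟨R, fun ψ c h0 hψ => ?_⟩
    have hc0 := hψ.nonneg
    rw [hUa]
    refine le_of_tendsto (ha ψ).norm (Eventually.of_forall fun j => ?_)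
    refine (hR _ _ (hasCompactSupport_cutoffMul _ _) (fun x hx => by simp [h0 x hx])
      (hcut j ψ c hψ)).trans ?_
    rw [div_mul_eq_mul_div, div_le_iff₀ (by positivity)]
    nlinarith [mul_nonneg hε.le hc0]
  · rw [hUa]
    refine tendsto_nhds_unique (ha _) ?_
    obtain ⟨L, hL0, hL⟩ := exists_derivBound_one_sub_cutoff n N
    -- Decay like 1/|x| of the derivatives of φ already makes (1 - χ)φ tend to 0 in the norms that
    -- bound u.
    obtain ⟨D, hD0, hD⟩ : ∃ D : ℝ, 0 ≤ D ∧ ∀ k ≤ N, ∀ x,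
        ‖x‖ * ‖iteratedFDeriv ℝ k (φ : Rn n → ℂ) x‖ ≤ D := by
      choose D hD using φ.decay 1
      refine ⟨∑ k ∈ Finset.range (N + 1), D k, Finset.sum_nonneg fun k _ => (hD k).1.le,
        fun k hk x => ?_⟩
      have := (hD k).2 x
      rw [pow_one] at this
      exact this.trans (Finset.single_le_sum (f := D) (fun i _ => (hD i).1.le)
        (by simpa [Nat.lt_succ_iff] using hk))
    have hb : ∀ j : ℕ, DerivBound N (2 ^ N * (L * (D * ((j : ℝ) + 1)⁻¹)))
        (φ - cutoffMul (hpos j) (schwartzToBdd φ) : 𝓢(Rn n, ℂ)) := by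
      intro j k hk x
      have e : ((φ - cutoffMul (hpos j) (schwartzToBdd φ) : 𝓢(Rn n, ℂ)) : Rn n → ℂ) =
          fun x => (1 - cutoff ((j : ℝ) + 1) x) * φ x := by
        funext x
        rw [_root_.sub_apply, cutoffMul_apply, sub_mul, one_mul]
        rfl
      rw [e]
      by_cases hx : ‖x‖ < j + 1
      · rw [iteratedFDeriv_eq_zero_of_norm_lt (R := (j : ℝ) + 1) (fun x hx => by
          rw [cutoff_eq_one (hpos j) hx.le, sub_self, zero_mul]) k hx, norm_zero]
        have := hpos j
        positivity
      · refine norm_iteratedFDeriv_mul_le_of_le (contDiff_const.sub (contDiff_cutoff _))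
          (φ.smooth ⊤) (fun k hk => hL _ (hone j) k hk x) (fun k hk => ?_) hk
        rw [← div_eq_mul_inv, le_div_iff₀ (hpos j), mul_comm]
        exact (mul_le_mul_of_nonneg_right (not_lt.1 hx) (norm_nonneg _)).trans (hD k hk x)
    have h0 : Tendsto (fun j : ℕ => C * (2 ^ N * (L * (D * ((j : ℝ) + 1)⁻¹)))) atTop (𝓝 0) := by
      have h1 := (((tendsto_one_div_add_atTop_nhds_zero_nat (𝕜 := ℝ)).const_mul
        (D)).const_mul L).const_mul ((2 : ℝ) ^ N) |>.const_mul C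
      simpa using h1
    have h2 : Tendsto (fun j : ℕ => u φ - u (cutoffMul (hpos j) (schwartzToBdd φ))) atTop
        (𝓝 0) := by
      refine squeeze_zero_norm (fun j => ?_) h0
      rw [← map_sub]
      exact hu _ _ (hb j)
    have h3 := (tendsto_const_nhds (x := u φ)).sub h2
    simpa using h3

/-! ### The topologies of `𝓑` and `𝓑̇` -/

/-- Outside a large ball tightness makes the contribution small, using only the common bound c;
inside, locally uniform convergence of the derivatives up to order N suffices. -/
lemma IsTight.tendsto_zero {n N : ℕ} {U : smoothBdd n →ₗ[ℂ] ℂ} (hU : IsTight N U) {ι : Type*}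
    {l : Filter ι} {ψ : ι → smoothBdd n} {c : ℝ}
    (hb : ∀ᶠ i in l, DerivBound N c (ψ i : Rn n → ℂ))
    (h0 : ∀ k ≤ N, ∀ R δ : ℝ, 0 < δ → ∀ᶠ i in l, ∀ x, ‖x‖ ≤ R →
      ‖iteratedFDeriv ℝ k (ψ i : Rn n → ℂ) x‖ ≤ δ) :
    Tendsto (fun i => U (ψ i)) l (𝓝 0) := by
  obtain ⟨C, hC0, hC⟩ := hU.bound
  obtain ⟨K, hK0, hK⟩ := exists_derivBound_cutoff n N
  obtain ⟨L, hL0, hL⟩ := exists_derivBound_one_sub_cutoff n N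
  rw [Metric.tendsto_nhds]
  intro ε hε
  -- |c| appears because c ≥ 0 is known only once the eventual bound is evaluated at some i.
  obtain ⟨R, hR⟩ := hU.tail (ε / 2 / (2 ^ N * (L * |c|) + 1)) (by positivity)
  set R' : ℝ := max R 1
  have hR1 : 1 ≤ R' := le_max_right _ _
  have hR0 : 0 < R' := by linarith
  set δ : ℝ := ε / 2 / (C * (2 ^ N * K) + 1)
  have hδ : 0 < δ := by positivity
  have h1 : ∀ᶠ i in l, ∀ k ≤ N, ∀ x, ‖x‖ ≤ 2 * R' →
      ‖iteratedFDeriv ℝ k (ψ i : Rn n → ℂ) x‖ ≤ δ := by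
    have := (Finset.range (N + 1)).eventually_all.2
      fun k hk => h0 k (by simpa [Nat.lt_succ_iff] using hk) (2 * R') δ hδ
    filter_upwards [this] with i hi k hk
    exact hi k (by simpa [Nat.lt_succ_iff] using hk)
  filter_upwards [hb, h1] with i hi1 hi2
  have hc0 := hi1.nonneg
  rw [abs_of_nonneg hc0] at hR
  set χ : smoothBdd n := cutoffBdd R' hR1
  have e : U (ψ i) = U (mulBdd χ (ψ i)) + U (mulBdd (oneBdd n - χ) (ψ i)) := by
    rw [← map_add]
    congr 1
    ext x
    change _ = cutoff R' x * _ + (1 - cutoff R' x) * _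
    ring
  have hA : ‖U (mulBdd χ (ψ i))‖ ≤ C * (2 ^ N * (K * δ)) := by
    exact hC _ _ (derivBound_cutoff_mul hR0 (hK R' hR1) (contDiff_smoothBdd _) hi2)
  have hB := hR (mulBdd (oneBdd n - χ) (ψ i)) (2 ^ N * (L * c))
    (fun x hx => by
      change (1 - cutoff R' x) * _ = 0
      rw [cutoff_eq_one hR0 (hx.le.trans (le_max_left _ _)), sub_self, zero_mul])
    ((hL R' hR1).mul (contDiff_const.sub (contDiff_cutoff _)) (contDiff_smoothBdd _) hi1)
  have hA' : C * (2 ^ N * (K * δ)) ≤ ε / 2 := by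
    have : C * (2 ^ N * (K * δ)) = ε / 2 * (C * (2 ^ N * K)) / (C * (2 ^ N * K) + 1) := by
      simp only [δ]
      ring
    rw [this, div_le_iff₀ (by positivity)]
    nlinarith
  have hB' : ε / 2 / (2 ^ N * (L * c) + 1) * (2 ^ N * (L * c)) < ε / 2 := by
    rw [div_mul_eq_mul_div, div_lt_iff₀ (by positivity)]
    nlinarith
  rw [dist_zero_right, e]
  linarith [norm_add_le (U (mulBdd χ (ψ i))) (U (mulBdd (oneBdd n - χ) (ψ i)))]

/-- All derivatives of an element of `𝓑`, as continuous functions. -/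
def derivsLM (n : ℕ) : smoothBdd n →ₗ[ℂ] ((k : ℕ) → C(Rn n, Rn n [×k]→L[ℝ] ℂ)) where
  toFun ψ k := ⟨iteratedFDeriv ℝ k (ψ : Rn n → ℂ),
    (contDiff_smoothBdd ψ).continuous_iteratedFDeriv (mod_cast le_top)⟩
  map_add' φ ψ := by
    ext k x : 2
    exact iteratedFDeriv_add_apply ((contDiff_smoothBdd φ).contDiffAt.of_le (mod_cast le_top))
      ((contDiff_smoothBdd ψ).contDiffAt.of_le (mod_cast le_top))
  map_smul' c ψ := by
    ext k x : 2
    exact iteratedFDeriv_const_smul_apply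
      ((contDiff_smoothBdd ψ).contDiffAt.of_le (mod_cast le_top))

/-- In terms of compact-open topologies the target is a locally convex space, and this structure
pulls back along the linear map `derivsLM`. -/
lemma smoothTopology_eq_induced (n : ℕ) :
    smoothTopology n = TopologicalSpace.induced (derivsLM n) inferInstance := by
  have h : IsInducing (fun (g : (k : ℕ) → C(Rn n, Rn n [×k]→L[ℝ] ℂ)) (k : ℕ) =>
      (g k).toUniformOnFunIsCompact) :=
    IsInducing.piMap fun k => ContinuousMap.isUniformEmbedding_toUniformOnFunIsCompact.isInducing
  rw [h.eq_induced, induced_compose]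
  rfl

/-- The coarsest refinement of the topology of `C^∞` for which `U` is continuous. -/
abbrev refinedTopology {n : ℕ} (U : smoothBdd n →ₗ[ℂ] ℂ) : TopologicalSpace (smoothBdd n) :=
  TopologicalSpace.induced ((derivsLM n).prod U) inferInstance

lemma tendsto_derivs {n k : ℕ} {ι : Type*} {l : Filter ι} {ψ : ι → smoothBdd n}
    {φ : smoothBdd n} (h : Tendsto (fun i => derivsLM n (ψ i) k) l (𝓝 (derivsLM n φ k)))
    (R δ : ℝ) (hδ : 0 < δ) : ∀ᶠ i in l, ∀ x, ‖x‖ ≤ R →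
      ‖iteratedFDeriv ℝ k ((ψ i - φ : smoothBdd n) : Rn n → ℂ) x‖ ≤ δ := by
  rw [ContinuousMap.tendsto_iff_forall_isCompact_tendstoUniformlyOn] at h
  have := Metric.tendstoUniformlyOn_iff.1 (h _ (isCompact_closedBall (0 : Rn n) R)) δ hδ
  filter_upwards [this] with i hi x hx
  have h1 := hi x (by simpa using hx)
  rw [dist_comm, dist_eq_norm] at h1
  have h2 : derivsLM n (ψ i - φ) k x = derivsLM n (ψ i) k x - derivsLM n φ k x := by
    rw [map_sub]
    rfl
  rw [← h2] at h1
  exact h1.le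

/-- Forcing U to be continuous changes nothing on bounded sets, since there U is already continuous
for the C^∞ topology by `IsTight.tendsto_zero`. -/
lemma IsTight.isAdmissibleTopology {n N : ℕ} {U : smoothBdd n →ₗ[ℂ] ℂ} (hU : IsTight N U) :
    IsAdmissibleTopology (refinedTopology U) := by
  refine ⟨topologicalAddGroup_induced _, continuousSMul_induced _,
    LocallyConvexSpace.induced (((derivsLM n).prod U).restrictScalars ℝ), fun S hS => ?_⟩
  apply le_antisymm
  · refine induced_mono ?_
    rw [smoothTopology_eq_induced, refinedTopology]
    rw [← continuous_iff_le_induced]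
    let : TopologicalSpace (smoothBdd n) :=
      TopologicalSpace.induced ((derivsLM n).prod U) inferInstance
    have : Continuous ((derivsLM n).prod U) := continuous_induced_dom
    exact continuous_fst.comp this
  · refine le_of_eq_of_le (b := TopologicalSpace.induced
      (derivsLM n ∘ (Subtype.val : S → smoothBdd n)) inferInstance)
      (by rw [smoothTopology_eq_induced, induced_compose]) ?_
    rw [← continuous_iff_le_induced]
    refine continuous_induced_rng.2 ?_
    let : TopologicalSpace S :=
      TopologicalSpace.induced (derivsLM n ∘ Subtype.val) inferInstance
    have h1 : Continuous (derivsLM n ∘ (Subtype.val : S → smoothBdd n)) := continuous_induced_dom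
    refine h1.prodMk (continuous_iff_continuousAt.2 fun φ => ?_)
    obtain ⟨c, hc⟩ : ∃ c : ℝ, ∀ ψ ∈ S, DerivBound N c (ψ : Rn n → ℂ) := by
      choose C hC using hS
      refine ⟨∑ k ∈ Finset.range (N + 1), |C k|, fun ψ hψ k hk x => (hC k ψ hψ x).trans ?_⟩
      exact (le_abs_self _).trans (Finset.single_le_sum (f := fun k => |C k|)
        (fun i _ => abs_nonneg _) (by simpa [Nat.lt_succ_iff] using hk))
    have h2 : Tendsto (fun ψ : S => U ((ψ : smoothBdd n) - φ)) (𝓝 φ) (𝓝 0) := by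
      refine hU.tendsto_zero (c := c + c) (Eventually.of_forall fun ψ =>
        (hc ψ ψ.2).sub (contDiff_smoothBdd _) (contDiff_smoothBdd _) (hc φ φ.2)) fun k hk R δ hδ =>
        tendsto_derivs ?_ R δ hδ
      exact ((continuous_apply k).comp h1).tendsto φ
    have h3 := h2.add_const (U φ)
    simpa [ContinuousAt] using h3

/-- The topology of 𝓑_c is finer than every admissible one, in particular than one built to make U
continuous. -/
lemma IsTight.continuous_bcTopology {n N : ℕ} {U : smoothBdd n →ₗ[ℂ] ℂ} (hU : IsTight N U) :
    @Continuous _ _ (bcTopology n) _ U := by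
  refine continuous_sInf_dom (t₁ := {t | IsAdmissibleTopology t}) hU.isAdmissibleTopology ?_
  let : TopologicalSpace (smoothBdd n) := refinedTopology U
  have : Continuous ((derivsLM n).prod U) := continuous_induced_dom
  exact continuous_snd.comp this

lemma IsTight.hasIntegral {n N : ℕ} {U : smoothBdd n →ₗ[ℂ] ℂ} (hU : IsTight N U)
    {u : 𝓢'(Rn n, ℂ)} (h : ∀ φ : 𝓢(Rn n, ℂ), U (schwartzToBdd φ) = u φ) :
    HasIntegral u (U (oneBdd n)) :=
  ⟨U, hU.continuous_bcTopology, h, rfl⟩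

/-- The inclusion of `𝓑̇` in `𝓑`. -/
def vanishingToBdd (n : ℕ) : smoothVanishing n →ₗ[ℂ] smoothBdd n where
  toFun φ := ⟨φ, φ.2.1, fun k => by
    have h := (φ.2.2 k).norm.eventually_le_const
      (show ‖(0 : Rn n [×k]→L[ℝ] ℂ)‖ < 1 by simp)
    obtain ⟨K, hK, hKc⟩ := mem_cocompact.1 h
    obtain ⟨C, hC⟩ := hK.exists_bound_of_continuousOn
      (φ.2.1.continuous_iteratedFDeriv (m := k) (mod_cast le_top)).continuousOn
    refine ⟨max C 1, fun x => ?_⟩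
    by_cases hx : x ∈ K
    · exact (hC x hx).trans (le_max_left _ _)
    · exact (hKc hx).trans (le_max_right _ _)⟩
  map_add' _ _ := rfl
  map_smul' _ _ := rfl

lemma IsTight.isIntegrableDistribution {n N : ℕ} {U : smoothBdd n →ₗ[ℂ] ℂ} (hU : IsTight N U)
    {u : 𝓢'(Rn n, ℂ)} (h : ∀ φ : 𝓢(Rn n, ℂ), U (schwartzToBdd φ) = u φ) :
    IsIntegrableDistribution u := by
  refine ⟨U ∘ₗ vanishingToBdd n, ?_, h⟩
  obtain ⟨C, hC0, hC⟩ := hU.bound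
  let : TopologicalSpace (smoothVanishing n) := vanishingTopology n
  refine continuous_iff_continuousAt.2 fun φ => Metric.tendsto_nhds.2 fun ε hε => ?_
  set δ : ℝ := ε / (C + 1)
  have hδ : 0 < δ := by positivity
  have hcont : Continuous (fun (ψ : smoothVanishing n) (k : ℕ) =>
      UniformFun.ofFun (iteratedFDeriv ℝ k (ψ : Rn n → ℂ))) := continuous_induced_dom
  have h1 : ∀ k : ℕ, ∀ᶠ ψ in 𝓝 φ, ∀ x,
      ‖iteratedFDeriv ℝ k ((ψ - φ : smoothVanishing n) : Rn n → ℂ) x‖ ≤ δ := by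
    intro k
    have h2 := ((continuous_apply k).comp hcont).tendsto φ
    have h3 := Metric.tendstoUniformly_iff.1 (UniformFun.tendsto_iff_tendstoUniformly.1 h2) δ hδ
    filter_upwards [h3] with ψ hψ x
    have h4 := hψ x
    rw [dist_comm, dist_eq_norm] at h4
    have e : iteratedFDeriv ℝ k ((ψ - φ : smoothVanishing n) : Rn n → ℂ) x =
        iteratedFDeriv ℝ k (ψ : Rn n → ℂ) x - iteratedFDeriv ℝ k (φ : Rn n → ℂ) x := by
      have h5 : derivsLM n (vanishingToBdd n (ψ - φ)) k x =
          derivsLM n (vanishingToBdd n ψ) k x - derivsLM n (vanishingToBdd n φ) k x := by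
        rw [map_sub, map_sub]
        rfl
      exact h5
    rw [e]
    exact h4.le
  have h2 := (Finset.range (N + 1)).eventually_all.2 fun k _ => h1 k
  filter_upwards [h2] with ψ hψ
  have h3 := hC (vanishingToBdd n (ψ - φ)) δ fun k hk x =>
    hψ k (by simpa [Nat.lt_succ_iff] using hk) x
  rw [dist_eq_norm, ← map_sub]
  refine h3.trans_lt ?_
  simp only [δ]
  rw [← mul_div_assoc, div_lt_iff₀ (by positivity)]
  nlinarith

/-- Multiplication by b costs a Leibniz constant and does not enlarge supports, so both halves of
tightness survive. -/
lemma IsTight.comp_mulBdd {n N : ℕ} {U : smoothBdd n →ₗ[ℂ] ℂ} (hU : IsTight N U)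
    (b : smoothBdd n) : IsTight N (U ∘ₗ mulBddLM b) := by
  obtain ⟨C, hC0, hC⟩ := hU.bound
  obtain ⟨d, hd⟩ := exists_derivBound_smoothBdd b N
  have hd0 := hd.nonneg
  refine ⟨⟨C * (2 ^ N * d), by positivity, fun ψ c hψ => ?_⟩, fun ε hε => ?_⟩
  · have h := hC (mulBdd b ψ) _ (hd.mul (contDiff_smoothBdd b) (contDiff_smoothBdd ψ) hψ)
    rw [LinearMap.comp_apply, mulBddLM_apply]
    linarith
  · obtain ⟨R, hR⟩ := hU.tail (ε / (2 ^ N * d + 1)) (by positivity)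
    refine ⟨R, fun ψ c h0 hψ => ?_⟩
    have hc0 := hψ.nonneg
    have h := hR (mulBdd b ψ) _ (fun x hx => by rw [mulBdd_apply, h0 x hx, mul_zero])
      (hd.mul (contDiff_smoothBdd b) (contDiff_smoothBdd ψ) hψ)
    rw [LinearMap.comp_apply, mulBddLM_apply]
    refine h.trans ?_
    rw [div_mul_eq_mul_div, div_le_iff₀ (by positivity)]
    nlinarith [mul_nonneg hε.le hc0]

/-! ### Uniqueness of ⟨u, 1⟩ -/

/-- Convergence for the infimum means convergence for each admissible topology. The cutoffs together
with 1 form a bounded set, on which each of these topologies is that of C^∞, and on a compact set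
the cutoffs are eventually 1. -/
lemma tendsto_cutoffMul_one {n : ℕ} :
    Tendsto (fun j : ℕ => schwartzToBdd
      (cutoffMul (show (0 : ℝ) < j + 1 by positivity) (oneBdd n))) atTop
      (@nhds _ (bcTopology n) (oneBdd n)) := by
  set ψ : ℕ → smoothBdd n := fun j => schwartzToBdd
      (cutoffMul (show (0 : ℝ) < j + 1 by positivity) (oneBdd n)) with hψ
  rw [nhds_sInf, tendsto_iInf]
  intro t
  rw [tendsto_iInf]
  rintro ⟨-, -, -, ht⟩
  set S : Set (smoothBdd n) := insert (oneBdd n) (Set.range ψ)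
  have hS : IsBddSubset S := by
    intro k
    obtain ⟨C, hC0, hC⟩ := exists_derivBound_cutoff n k
    obtain ⟨d, hd⟩ := exists_derivBound_smoothBdd (oneBdd n) k
    refine ⟨max d (2 ^ k * (C * d)), ?_⟩
    rintro φ (rfl | ⟨j, rfl⟩) x
    · exact (hd k le_rfl x).trans (le_max_left _ _)
    · exact ((hC _ (by simp)).mul (contDiff_cutoff _) (contDiff_smoothBdd _) hd k le_rfl x).trans
        (le_max_right _ _)
  have h1 := ht S hS
  set ψ' : ℕ → S := fun j => ⟨ψ j, Or.inr ⟨j, rfl⟩⟩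
  have h2 : Tendsto ψ' atTop (@nhds _ (TopologicalSpace.induced (Subtype.val : S → smoothBdd n)
      (smoothTopology n)) ⟨oneBdd n, Or.inl rfl⟩) := by
    rw [smoothTopology_eq_induced, induced_compose, nhds_induced, tendsto_comap_iff,
      tendsto_pi_nhds]
    intro k
    rw [ContinuousMap.tendsto_iff_forall_isCompact_tendstoUniformlyOn]
    intro K hK
    obtain ⟨R, hR⟩ := hK.isBounded.exists_norm_le
    obtain ⟨J, hJ⟩ := exists_nat_ge R
    rw [Metric.tendstoUniformlyOn_iff]
    intro ε hε
    filter_upwards [eventually_ge_atTop J] with j hj x hx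
    have h3 : (ψ j : Rn n → ℂ) =ᶠ[𝓝 x] (oneBdd n : Rn n → ℂ) := by
      have h4 : ‖x‖ < (j : ℝ) + 1 := by
        have : (J : ℝ) ≤ j := by exact_mod_cast hj
        linarith [hR x hx]
      filter_upwards [continuous_norm.continuousAt.eventually_lt_const h4] with z hz
      change cutoff _ z * (1 : ℂ) = 1
      rw [cutoff_eq_one (by positivity) hz.le, mul_one]
    have h5 := (h3.iteratedFDeriv ℝ k).eq_of_nhds
    change dist (iteratedFDeriv ℝ k (oneBdd n : Rn n → ℂ) x)
      (iteratedFDeriv ℝ k (ψ j : Rn n → ℂ) x) < ε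
    rw [h5, dist_self]
    exact hε
  rw [← h1, nhds_induced, tendsto_comap_iff] at h2
  exact h2

lemma HasIntegral.unique {n : ℕ} {u : 𝓢'(Rn n, ℂ)} {c d : ℂ} (hc : HasIntegral u c)
    (hd : HasIntegral u d) : c = d := by
  have key : ∀ e : ℂ, HasIntegral u e → Tendsto (fun j : ℕ => u
      (cutoffMul (show (0 : ℝ) < j + 1 by positivity) (oneBdd n))) atTop (𝓝 e) := by
    rintro e ⟨T, hT, hTu, rfl⟩
    have h1 := (@Continuous.tendsto _ _ (bcTopology n) _ _ hT (oneBdd n)).comp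
      tendsto_cutoffMul_one
    refine h1.congr fun j => ?_
    exact hTu _
  exact tendsto_nhds_unique (key c hc) (key d hd)

/-! ### Derivatives of the weight and of the kernel -/

lemma weight_pos {n : ℕ} (μ : ℝ) (x : Rn n) : 0 < weight μ x := by
  unfold weight
  positivity

lemma weight_mul_weight_neg {n : ℕ} (μ : ℝ) (x : Rn n) : weight μ x * weight (-μ) x = 1 := by
  unfold weight
  rw [← Real.rpow_add (by positivity)]
  simp [neg_div]

lemma weight_le_of_norm_le {n : ℕ} {μ : ℝ} (hμ : 0 ≤ μ) {x : Rn n} {R : ℝ} (hx : ‖x‖ ≤ R) :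
    weight μ x ≤ (1 + R ^ 2) ^ (μ / 2) :=
  Real.rpow_le_rpow (by positivity) (by gcongr) (by positivity)

lemma contDiff_weight {n : ℕ} (μ : ℝ) : ContDiff ℝ ∞ (fun x : Rn n => weight μ x) := by
  have := contDiff_norm_sq_add_rpow (n := n) (μ / 2) one_pos
  simpa [weight, add_comm] using this

/-- Differentiation only lowers the exponent and 1 + |x|² ≥ 1; discarding the gain leaves the weight
itself, ready to cancel against the decay of the kernel. -/
lemma exists_norm_iteratedFDeriv_weight_le (n N : ℕ) (μ : ℝ) :
    ∃ C : ℝ, 0 ≤ C ∧ ∀ k ≤ N, ∀ x : Rn n,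
      ‖iteratedFDeriv ℝ k (fun x => (weight μ x : ℂ)) x‖ ≤ C * weight μ x := by
  choose C hC0 hC using fun k => norm_iteratedFDeriv_norm_sq_add_rpow_le n k μ
  refine ⟨∑ k ∈ Finset.range (N + 1), C k, Finset.sum_nonneg fun k _ => hC0 k, fun k hk x => ?_⟩
  rw [norm_iteratedFDeriv_ofReal (contDiff_weight μ)]
  have h := hC k 1 one_pos x
  have e : (fun ξ : Rn n => (‖ξ‖ ^ 2 + 1 ^ 2) ^ (μ / 2)) = fun x => weight μ x := by
    funext ξ
    rw [weight, one_pow, add_comm]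
  rw [e] at h
  refine h.trans ?_
  refine mul_le_mul (Finset.single_le_sum (f := C) (fun i _ => hC0 i)
    (by simpa [Nat.lt_succ_iff] using hk)) ?_ (by positivity)
    (Finset.sum_nonneg fun k _ => hC0 k)
  rw [weight, one_pow, add_comm]
  exact Real.rpow_le_rpow_of_exponent_le (by nlinarith [sq_nonneg ‖x‖])
    (by have : (0 : ℝ) ≤ k := by positivity
        linarith)

lemma contDiff_kernel {n : ℕ} (α : ℝ) {y : ℝ} (hy : 0 < y) :
    ContDiff ℝ ∞ (fun x : Rn n => (kernel α x y : ℂ)) := (kernel_hasTemperateGrowth α hy).1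

/-- The constant is uniform in y, and the factor (|x|² + y²)^{-1/2} from each derivative is kept: it
determines the power of 1/y lost at low heights. -/
lemma exists_norm_iteratedFDeriv_kernel_le (n N : ℕ) (α : ℝ) :
    ∃ C : ℝ, 0 ≤ C ∧ ∀ k ≤ N, ∀ y : ℝ, 0 < y → ∀ x : Rn n,
      ‖iteratedFDeriv ℝ k (fun x => (kernel α x y : ℂ)) x‖ ≤
        C * (y ^ (α + 1) * (‖x‖ ^ 2 + y ^ 2) ^ (-(α + n + 1 + k) / 2)) := by
  choose C hC0 hC using fun k => norm_iteratedFDeriv_norm_sq_add_rpow_le n k (-(α + n + 1))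
  set A : ℝ := Real.Gamma ((α + n + 1) / 2) / (Real.Gamma ((α + 1) / 2) * Real.pi ^ ((n : ℝ) / 2))
  refine ⟨|A| * ∑ k ∈ Finset.range (N + 1), C k,
    mul_nonneg (abs_nonneg _) (Finset.sum_nonneg fun k _ => hC0 k), fun k hk y hy x => ?_⟩
  have h := hC k y hy x
  have hsm := contDiff_norm_sq_add_rpow (n := n) (-(α + n + 1) / 2) hy
  have e : (fun x : Rn n => kernel α x y) =
      (A * y ^ (α + 1)) • fun x => (‖x‖ ^ 2 + y ^ 2) ^ (-(α + n + 1) / 2) := by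
    funext ξ
    rw [kernel, Pi.smul_apply, smul_eq_mul, neg_div, Real.rpow_neg (by positivity), mul_assoc,
      div_eq_mul_inv (y ^ (α + 1))]
  rw [norm_iteratedFDeriv_ofReal (by rw [e]; exact hsm.const_smul (A * y ^ (α + 1))), e,
    iteratedFDeriv_const_smul_apply (hsm.contDiffAt.of_le (mod_cast le_top)), norm_smul, norm_mul,
    Real.norm_eq_abs, Real.norm_of_nonneg (by positivity : 0 ≤ y ^ (α + 1))]
  have h2 : C k ≤ ∑ k ∈ Finset.range (N + 1), C k := Finset.single_le_sum (f := C)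
    (fun i _ => hC0 i) (by simpa [Nat.lt_succ_iff] using hk)
  have e2 : -(α + n + 1) - (k : ℝ) = -(α + n + 1 + k) := by ring
  rw [e2] at h
  calc _ ≤ |A| * y ^ (α + 1) * ((∑ k ∈ Finset.range (N + 1), C k) *
        (‖x‖ ^ 2 + y ^ 2) ^ (-(α + n + 1 + k) / 2)) := by
        refine mul_le_mul_of_nonneg_left (h.trans ?_) (by positivity)
        gcongr
    _ = _ := by ring

lemma rpow_mul_rpow_neg_le {a b q μ : ℝ} (ha : 0 ≤ a) (hb : 0 ≤ b) (hq : 0 < q) (hμ : 0 ≤ μ)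
    (h : b ≤ a * q) : b ^ (μ / 2) * q ^ (-μ / 2) ≤ a ^ (μ / 2) := by
  rw [neg_div, Real.rpow_neg hq.le, ← div_eq_mul_inv, div_le_iff₀ (by positivity),
    ← Real.mul_rpow ha hq.le]
  exact Real.rpow_le_rpow hb h (by positivity)

lemma rpow_neg_half_le {q y : ℝ} (hy : 0 < y) (h : y ^ 2 ≤ q) {k N : ℕ} (hk : k ≤ N) :
    q ^ (-(k : ℝ) / 2) ≤ max 1 (y ^ (-(N : ℝ))) := by
  have h1 : q ^ (-(k : ℝ) / 2) ≤ y ^ (-(k : ℝ)) := by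
    have : y ^ (-(k : ℝ)) = (y ^ 2) ^ (-(k : ℝ) / 2) := by
      rw [← Real.rpow_natCast, ← Real.rpow_mul hy.le]
      congr 1
      push_cast
      ring
    rw [this]
    refine Real.rpow_le_rpow_of_nonpos (by positivity) h ?_
    have : (0 : ℝ) ≤ k := by positivity
    linarith
  refine h1.trans ?_
  rcases le_total 1 y with h2 | h2
  · exact (Real.rpow_le_one_of_one_le_of_nonpos h2 (by simp)).trans (le_max_left _ _)
  · refine le_trans ?_ (le_max_right _ _)
    refine Real.rpow_le_rpow_of_exponent_ge hy h2 ?_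
    have : (k : ℝ) ≤ N := by exact_mod_cast hk
    linarith

lemma one_add_norm_sq_le {n : ℕ} (x η : Rn n) :
    1 + ‖η‖ ^ 2 ≤ 1 + 2 * ‖x‖ ^ 2 + 2 * ‖η - x‖ ^ 2 := by
  have h : ‖η‖ ≤ ‖x‖ + ‖η - x‖ := by
    simpa using norm_add_le x (η - x)
  nlinarith [sq_nonneg (‖x‖ - ‖η - x‖), norm_nonneg η, norm_nonneg x, norm_nonneg (η - x)]

/-! ### Translated kernels as test functions -/

lemma iteratedFDeriv_kernel_sub {n : ℕ} (α y : ℝ) (k : ℕ) (x η : Rn n) :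
    iteratedFDeriv ℝ k (fun η : Rn n => (kernel α (η - x) y : ℂ)) η =
      iteratedFDeriv ℝ k (fun x : Rn n => (kernel α x y : ℂ)) (η - x) :=
  iteratedFDeriv_comp_sub (f := fun x : Rn n => (kernel α x y : ℂ)) k x η

lemma contDiff_kernel_sub {n : ℕ} (α : ℝ) {y : ℝ} (hy : 0 < y) (x : Rn n) :
    ContDiff ℝ ∞ (fun η : Rn n => (kernel α (η - x) y : ℂ)) :=
  (contDiff_kernel α hy).comp (contDiff_id.sub contDiff_const)

/-- Decay of the derivatives of the translated kernel, for fixed `y`. -/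
lemma exists_norm_iteratedFDeriv_kernel_sub_le (n N : ℕ) {α y : ℝ} (hα : -1 < α) (hy : 0 < y) :
    ∃ A : ℝ, 0 ≤ A ∧ ∀ k ≤ N, ∀ x η : Rn n,
      ‖iteratedFDeriv ℝ k (fun x => (kernel α x y : ℂ)) (η - x)‖ ≤
        A * weight (α + n + 1) x * weight (-(α + n + 1)) η := by
  obtain ⟨C, hC0, hC⟩ := exists_norm_iteratedFDeriv_kernel_le n N α
  have hn : (0 : ℝ) ≤ n := by positivity
  set μ : ℝ := α + n + 1 with hμ
  have hμ0 : 0 ≤ μ := by linarith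
  set M : ℝ := max 1 (y ^ (-(N : ℝ)))
  have hM : 0 ≤ M := zero_le_one.trans (le_max_left _ _)
  -- Chosen so that 1 + |η|² ≤ a (1 + |x|²) q with q = |η - x|² + y²; the factor M absorbs the extra
  -- powers of q coming from derivatives, as q ≥ y².
  set a : ℝ := 2 * (1 + (y ^ 2)⁻¹)
  have ha : 0 ≤ a := by positivity
  refine ⟨C * (y ^ (α + 1) * (a ^ (μ / 2) * M)), by positivity, fun k hk x η => ?_⟩
  refine (hC k hk y hy (η - x)).trans ?_
  set q : ℝ := ‖η - x‖ ^ 2 + y ^ 2 with hq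
  have hq0 : 0 < q := by positivity
  have e : q ^ (-(μ + k) / 2) = q ^ (-μ / 2) * q ^ (-(k : ℝ) / 2) := by
    rw [← Real.rpow_add hq0]
    congr 1
    ring
  have h1 : 1 + ‖η‖ ^ 2 ≤ (a * (1 + ‖x‖ ^ 2)) * q := by
    refine (one_add_norm_sq_le x η).trans ?_
    have h2 : 1 ≤ (1 + (y ^ 2)⁻¹) * q := by
      rw [add_mul, one_mul, hq, mul_add, inv_mul_cancel₀ (by positivity)]
      have : 0 ≤ (y ^ 2)⁻¹ * ‖η - x‖ ^ 2 := by positivity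
      nlinarith [sq_nonneg ‖η - x‖, sq_nonneg y]
    have h3 : ‖η - x‖ ^ 2 ≤ (1 + (y ^ 2)⁻¹) * q := by
      rw [add_mul, one_mul]
      have : 0 ≤ (y ^ 2)⁻¹ * q := by positivity
      nlinarith [sq_nonneg y]
    have h4 : ‖x‖ ^ 2 * 1 ≤ ‖x‖ ^ 2 * ((1 + (y ^ 2)⁻¹) * q) :=
      mul_le_mul_of_nonneg_left h2 (sq_nonneg _)
    have e2 : a * (1 + ‖x‖ ^ 2) * q = 2 * ((1 + (y ^ 2)⁻¹) * q) +
        2 * (‖x‖ ^ 2 * ((1 + (y ^ 2)⁻¹) * q)) := by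
      simp only [a]
      ring
    rw [e2]
    have h5 : 1 ≤ 2 * ((1 + (y ^ 2)⁻¹) * q) - 2 * ‖η - x‖ ^ 2 := by
      have : 0 ≤ (y ^ 2)⁻¹ * ‖η - x‖ ^ 2 := by positivity
      have e3 : (1 + (y ^ 2)⁻¹) * q = ‖η - x‖ ^ 2 + y ^ 2 + ((y ^ 2)⁻¹ * ‖η - x‖ ^ 2 + 1) := by
        rw [add_mul, one_mul, hq, mul_add, inv_mul_cancel₀ (by positivity)]
      nlinarith [sq_nonneg y]
    linarith
  have h2 := rpow_mul_rpow_neg_le (μ := μ) (by positivity) (by positivity) hq0 hμ0 h1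
  rw [Real.mul_rpow ha (by positivity)] at h2
  have h3 : q ^ (-μ / 2) ≤ a ^ (μ / 2) * weight μ x * weight (-μ) η := by
    have h4 := weight_mul_weight_neg μ η
    have h5 := weight_pos (-μ) η
    calc q ^ (-μ / 2) = (weight μ η * q ^ (-μ / 2)) * weight (-μ) η := by
          rw [mul_right_comm, h4, one_mul]
      _ ≤ _ := mul_le_mul_of_nonneg_right h2 h5.le
  have h4 := rpow_neg_half_le hy (q := q) (by rw [hq]; nlinarith [sq_nonneg ‖η - x‖]) hk
  rw [e]
  have hw := weight_pos μ x
  have hw' := weight_pos (-μ) η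
  calc C * (y ^ (α + 1) * (q ^ (-μ / 2) * q ^ (-(k : ℝ) / 2))) ≤
        C * (y ^ (α + 1) * ((a ^ (μ / 2) * weight μ x * weight (-μ) η) * M)) := by gcongr
    _ = _ := by ring

/-- The test function `η ↦ w^{α+n+1}(η) 𝒦_α(η - x, y)`. -/
def poissonTest {n : ℕ} {α y : ℝ} (hα : -1 < α) (hy : 0 < y) (x : Rn n) : smoothBdd n :=
  ⟨fun η => (weight (α + n + 1) η : ℂ) * (kernel α (η - x) y : ℂ),
    mem_smoothBdd_of_derivBound
      ((weight_hasTemperateGrowth (α + n + 1)).1.mul (contDiff_kernel_sub α hy x)) fun N => by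
      obtain ⟨C, hC0, hC⟩ := exists_norm_iteratedFDeriv_weight_le n N (α + n + 1)
      obtain ⟨A, hA0, hA⟩ := exists_norm_iteratedFDeriv_kernel_sub_le n N hα hy
      refine ⟨2 ^ N * (C * (A * weight (α + n + 1) x)), fun k hk η => ?_⟩
      refine (norm_iteratedFDeriv_mul_le_of_le (weight_hasTemperateGrowth (α + n + 1)).1
        (contDiff_kernel_sub α hy x) (fun k hk => hC k hk η)
        (fun k hk => (iteratedFDeriv_kernel_sub α y k x η).symm ▸ hA k hk x η) hk).trans_eq ?_
      have := weight_mul_weight_neg (α + n + 1) η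
      linear_combination 2 ^ N * C * A * weight (α + n + 1) x * this⟩

lemma poissonTest_apply {n : ℕ} {α y : ℝ} (hα : -1 < α) (hy : 0 < y) (x η : Rn n) :
    (poissonTest hα hy x : Rn n → ℂ) η =
      (weight (α + n + 1) η : ℂ) * (kernel α (η - x) y : ℂ) := rfl

lemma exists_derivBound_poissonTest (n N : ℕ) {α y : ℝ} (hα : -1 < α) (hy : 0 < y) :
    ∃ A : ℝ, 0 ≤ A ∧ ∀ x : Rn n,
      DerivBound N (A * weight (α + n + 1) x) (poissonTest hα hy x : Rn n → ℂ) := by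
  obtain ⟨C, hC0, hC⟩ := exists_norm_iteratedFDeriv_weight_le n N (α + n + 1)
  obtain ⟨A, hA0, hA⟩ := exists_norm_iteratedFDeriv_kernel_sub_le n N hα hy
  refine ⟨2 ^ N * C * A, by positivity, fun x k hk η => ?_⟩
  refine (norm_iteratedFDeriv_mul_le_of_le (weight_hasTemperateGrowth (α + n + 1)).1
    (contDiff_kernel_sub α hy x) (fun k hk => hC k hk η)
    (fun k hk => (iteratedFDeriv_kernel_sub α y k x η).symm ▸ hA k hk x η) hk).trans_eq ?_
  have := weight_mul_weight_neg (α + n + 1) η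
  linear_combination 2 ^ N * C * A * weight (α + n + 1) x * this

/-- `x ↦ poissonTest x` is locally Lipschitz, uniformly with all derivatives. -/
lemma exists_derivBound_poissonTest_sub (n N : ℕ) {α y : ℝ} (hα : -1 < α) (hy : 0 < y) (R : ℝ) :
    ∃ A : ℝ, 0 ≤ A ∧ ∀ x x' : Rn n, ‖x‖ ≤ R → ‖x'‖ ≤ R →
      DerivBound N (A * ‖x - x'‖)
        ((poissonTest hα hy x - poissonTest hα hy x' : smoothBdd n) : Rn n → ℂ) := by
  obtain ⟨C, hC0, hC⟩ := exists_norm_iteratedFDeriv_weight_le n N (α + n + 1)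
  -- Order N + 1, since the mean value inequality in x spends one derivative.
  obtain ⟨A, hA0, hA⟩ := exists_norm_iteratedFDeriv_kernel_sub_le n (N + 1) hα hy
  have hn : (0 : ℝ) ≤ n := by positivity
  have hμ0 : 0 ≤ α + n + 1 := by linarith
  set B : ℝ := (1 + R ^ 2) ^ ((α + n + 1) / 2)
  have hB0 : 0 ≤ B := by positivity
  refine ⟨2 ^ N * C * A * B, by positivity, fun x x' hx hx' k hk η => ?_⟩
  have e : ((poissonTest hα hy x - poissonTest hα hy x' : smoothBdd n) : Rn n → ℂ) =
      fun η => (weight (α + n + 1) η : ℂ) *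
        ((kernel α (η - x) y : ℂ) - (kernel α (η - x') y : ℂ)) := by
    funext η
    change (poissonTest hα hy x : Rn n → ℂ) η - (poissonTest hα hy x' : Rn n → ℂ) η = _
    rw [poissonTest_apply, poissonTest_apply, mul_sub]
  have hd : ∀ k ≤ N, ‖iteratedFDeriv ℝ k
      (fun η : Rn n => (kernel α (η - x) y : ℂ) - (kernel α (η - x') y : ℂ)) η‖ ≤
        A * B * weight (-(α + n + 1)) η * ‖x - x'‖ := by
    intro k hk
    have e2 : iteratedFDeriv ℝ k
        (fun η : Rn n => (kernel α (η - x) y : ℂ) - (kernel α (η - x') y : ℂ)) η =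
        iteratedFDeriv ℝ k (fun x : Rn n => (kernel α x y : ℂ)) (η - x) -
        iteratedFDeriv ℝ k (fun x : Rn n => (kernel α x y : ℂ)) (η - x') := by
      rw [← iteratedFDeriv_kernel_sub, ← iteratedFDeriv_kernel_sub]
      exact iteratedFDeriv_sub_apply
        ((contDiff_kernel_sub α hy x).contDiffAt.of_le (mod_cast le_top))
        ((contDiff_kernel_sub α hy x').contDiffAt.of_le (mod_cast le_top))
    rw [e2]
    have hdiff : Differentiable ℝ (iteratedFDeriv ℝ k (fun x : Rn n => (kernel α x y : ℂ))) :=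
      (contDiff_kernel α hy).differentiable_iteratedFDeriv (mod_cast ENat.natCast_lt_top k)
    have h1 := (convex_closedBall (0 : Rn n) R).norm_image_sub_le_of_norm_fderiv_le (𝕜 := ℝ)
      (f := fun z => iteratedFDeriv ℝ k (fun x : Rn n => (kernel α x y : ℂ)) (η - z))
      (C := A * B * weight (-(α + n + 1)) η) (x := x') (y := x)
      (fun z _ => (hdiff _).comp z (by fun_prop)) (fun z hz => ?_) (by simpa using hx')
      (by simpa using hx)
    · exact h1
    · have e3 := (((hdiff (η - z)).hasFDerivAt).comp z ((hasFDerivAt_id z).const_sub η)).fderiv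
      have e4 : ‖fderiv ℝ (fun z => iteratedFDeriv ℝ k (fun x : Rn n => (kernel α x y : ℂ))
          (η - z)) z‖ = ‖iteratedFDeriv ℝ (k + 1) (fun x : Rn n => (kernel α x y : ℂ)) (η - z)‖ := by
        rw [← norm_fderiv_iteratedFDeriv]
        refine (congrArg norm e3).trans ?_
        rw [ContinuousLinearMap.comp_neg, norm_neg, ContinuousLinearMap.comp_id]
      rw [e4]
      refine (hA (k + 1) (by lia) z η).trans ?_
      have := weight_pos (-(α + n + 1)) η
      gcongr
      exact weight_le_of_norm_le hμ0 (by simpa using hz)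
  rw [e]
  refine (norm_iteratedFDeriv_mul_le_of_le (weight_hasTemperateGrowth (α + n + 1)).1
    ((contDiff_kernel_sub α hy x).sub (contDiff_kernel_sub α hy x')) (fun k hk => hC k hk η)
    hd hk).trans_eq ?_
  have := weight_mul_weight_neg (α + n + 1) η
  linear_combination 2 ^ N * C * A * B * ‖x - x'‖ * this

/-! ### Superpositions of elements of `𝓑` -/

open scoped BoundedContinuousFunction

/-- The Banach space of bounded continuous jets of order `N`. -/
abbrev Jets (n N : ℕ) : Type := Rn n →ᵇ ((k : Fin (N + 1)) → Rn n [×(k : ℕ)]→L[ℝ] ℂ)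

instance instNormedAddCommGroupJets (n N : ℕ) : NormedAddCommGroup (Jets n N) := inferInstance

instance instNormedSpaceJets (n N : ℕ) : NormedSpace ℂ (Jets n N) := inferInstance

/-- The jet of order `N` of an element of `𝓑`. -/
def jet {n : ℕ} (N : ℕ) : smoothBdd n →ₗ[ℂ] Jets n N where
  toFun ψ := BoundedContinuousFunction.ofNormedAddCommGroup
    (fun x (k : Fin (N + 1)) => iteratedFDeriv ℝ (k : ℕ) (ψ : Rn n → ℂ) x)
    (continuous_pi fun k => (contDiff_smoothBdd ψ).continuous_iteratedFDeriv (mod_cast le_top))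
    (exists_derivBound_smoothBdd ψ N).choose fun x => by
      have h := (exists_derivBound_smoothBdd ψ N).choose_spec
      exact (pi_norm_le_iff_of_nonneg h.nonneg).2 fun k => h k (by lia) x
  map_add' φ ψ := by
    ext x : 1
    funext k
    exact congrFun (congrArg DFunLike.coe (congrFun ((derivsLM n).map_add φ ψ) k)) x
  map_smul' c ψ := by
    ext x : 1
    funext k
    exact congrFun (congrArg DFunLike.coe (congrFun ((derivsLM n).map_smul c ψ) k)) x

/-- The value at a point of one component of a jet. -/
def jetEval {n N : ℕ} (η : Rn n) (k : Fin (N + 1)) : Jets n N →L[ℂ] (Rn n [×(k : ℕ)]→L[ℝ] ℂ) :=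
  (ContinuousLinearMap.proj (R := ℂ) (φ := fun k : Fin (N + 1) => Rn n [×(k : ℕ)]→L[ℝ] ℂ) k).comp
    (BoundedContinuousFunction.evalCLM ℂ η)

lemma norm_jet_le_iff {n N : ℕ} {ψ : smoothBdd n} {c : ℝ} (hc : 0 ≤ c) :
    ‖jet N ψ‖ ≤ c ↔ DerivBound N c (ψ : Rn n → ℂ) := by
  rw [BoundedContinuousFunction.norm_le hc]
  constructor
  · intro h k hk x
    exact (pi_norm_le_iff_of_nonneg hc).1 (h x) ⟨k, by lia⟩
  · exact fun h x => (pi_norm_le_iff_of_nonneg hc).2 fun k => h k (by lia) x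

lemma jet_injective (n N : ℕ) : Function.Injective (jet (n := n) N) := by
  intro φ ψ h
  ext x
  have h1 := congrArg (fun J : Jets n N => J x ⟨0, by lia⟩ (fun i => i.elim0)) h
  exact h1

/-- A linear form on `𝓑` bounded by derivatives of order at most `N` extends to the jets. -/
lemma IsTight.exists_extension_jets {n N : ℕ} {U : smoothBdd n →ₗ[ℂ] ℂ} (hU : IsTight N U) :
    ∃ V : StrongDual ℂ (Jets n N), ∀ ψ, V (jet N ψ) = U ψ := by
  obtain ⟨C, hC0, hC⟩ := hU.bound
  set e := LinearEquiv.ofInjective (jet (n := n) N) (jet_injective n N)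
  set L : LinearMap.range (jet (n := n) N) →ₗ[ℂ] ℂ := U ∘ₗ e.symm.toLinearMap
  have hL : ∀ z, ‖L z‖ ≤ C * ‖z‖ := by
    intro z
    refine hC _ _ ((norm_jet_le_iff (norm_nonneg _)).1 ?_)
    have : jet N (e.symm z) = z := congrArg Subtype.val (e.apply_symm_apply z)
    exact (congrArg norm this).le
  -- Hahn–Banach: on the Banach space of jets, Bochner integrals exist and commute with V.
  obtain ⟨V, hV, -⟩ := exists_extension_norm_eq (LinearMap.range (jet (n := n) N))
    (L.mkContinuous C hL)
  refine ⟨V, fun ψ => ?_⟩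
  have h := hV (e ψ)
  rw [LinearMap.mkContinuous_apply, LinearMap.comp_apply, LinearEquiv.coe_coe,
    LinearEquiv.symm_apply_apply] at h
  exact h

variable {n : ℕ} {g : Rn n → smoothBdd n} {φ : Rn n → ℂ}

lemma integrable_smul_jet (hg : ∀ N, Continuous fun x => jet N (g x)) (hφ : Continuous φ)
    {ρ : Rn n → ℝ} (hρ : ∀ N, ∃ A : ℝ, 0 ≤ A ∧ ∀ x, ‖jet N (g x)‖ ≤ A * ρ x)
    (hint : Integrable fun x => ‖φ x‖ * ρ x) (N : ℕ) :
    Integrable fun x => φ x • jet N (g x) := by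
  obtain ⟨A, hA0, hA⟩ := hρ N
  refine (hint.const_mul A).mono' (hφ.smul (hg N)).aestronglyMeasurable
    (Eventually.of_forall fun x => ?_)
  rw [norm_smul]
  calc ‖φ x‖ * ‖jet N (g x)‖ ≤ ‖φ x‖ * (A * ρ x) :=
        mul_le_mul_of_nonneg_left (hA x) (norm_nonneg _)
    _ = _ := by ring

lemma continuous_iteratedFDeriv_apply (hg : ∀ N, Continuous fun x => jet N (g x)) (k : ℕ)
    (η : Rn n) : Continuous fun x => iteratedFDeriv ℝ k (g x : Rn n → ℂ) η :=
  (jetEval η (⟨k, by lia⟩ : Fin (k + 1))).continuous.comp (hg k)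

lemma norm_iteratedFDeriv_le_norm_jet {n : ℕ} (ψ : smoothBdd n) (k : ℕ) (η : Rn n) :
    ‖iteratedFDeriv ℝ k (ψ : Rn n → ℂ) η‖ ≤ ‖jet k ψ‖ :=
  (norm_jet_le_iff (N := k) (norm_nonneg (jet k ψ))).1 le_rfl k le_rfl η

/-- Differentiation under the integral sign: up to a constant, |φ| ρ dominates the integrands of
orders k and k + 1 for all η at once. -/
lemma hasFDerivAt_integral_iteratedFDeriv (hg : ∀ N, Continuous fun x => jet N (g x))
    (hφ : Continuous φ) {ρ : Rn n → ℝ}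
    (hρ : ∀ N, ∃ A : ℝ, 0 ≤ A ∧ ∀ x, ‖jet N (g x)‖ ≤ A * ρ x)
    (hint : Integrable fun x => ‖φ x‖ * ρ x) (k : ℕ) (η : Rn n) :
    HasFDerivAt (fun η => ∫ x, φ x • iteratedFDeriv ℝ k (g x : Rn n → ℂ) η)
      (∫ x, φ x • iteratedFDeriv ℝ (k + 1) (g x : Rn n → ℂ) η).curryLeft η := by
  obtain ⟨A, hA0, hA⟩ := hρ k
  obtain ⟨B, hB0, hB⟩ := hρ (k + 1)
  set E := continuousMultilinearCurryLeftEquiv ℝ (fun _ : Fin (k + 1) => Rn n) ℂ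
  have hbd : ∀ (k : ℕ) (A : ℝ), (∀ x, ‖jet k (g x)‖ ≤ A * ρ x) → ∀ x η,
      ‖φ x • iteratedFDeriv ℝ k (g x : Rn n → ℂ) η‖ ≤ A * (‖φ x‖ * ρ x) := by
    intro k A hA x η
    rw [norm_smul]
    calc _ ≤ ‖φ x‖ * (A * ρ x) := mul_le_mul_of_nonneg_left
          ((norm_iteratedFDeriv_le_norm_jet _ _ _).trans (hA x)) (norm_nonneg _)
      _ = _ := by ring
  have hmeas : ∀ (k : ℕ) (η : Rn n), AEStronglyMeasurable
      (fun x => φ x • iteratedFDeriv ℝ k (g x : Rn n → ℂ) η) volume := fun k η =>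
    (hφ.smul (continuous_iteratedFDeriv_apply hg k η)).aestronglyMeasurable
  have h := hasFDerivAt_integral_of_dominated_of_fderiv_le (𝕜 := ℝ) (μ := volume)
    (F := fun η x => φ x • iteratedFDeriv ℝ k (g x : Rn n → ℂ) η)
    (F' := fun η x => E (φ x • iteratedFDeriv ℝ (k + 1) (g x : Rn n → ℂ) η))
    (x₀ := η) (s := Set.univ) (bound := fun x => B * (‖φ x‖ * ρ x)) univ_mem
    (Eventually.of_forall fun η => hmeas k η)
    ((hint.const_mul A).mono' (hmeas k η) (Eventually.of_forall fun x => hbd k A hA x η))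
    (E.continuous.comp_aestronglyMeasurable (hmeas (k + 1) η))
    (Eventually.of_forall fun x η _ => by
      rw [E.norm_map]
      exact hbd (k + 1) B hB x η)
    (hint.const_mul B)
    (Eventually.of_forall fun x η _ => by
      have h1 : DifferentiableAt ℝ (iteratedFDeriv ℝ k (g x : Rn n → ℂ)) η :=
        (contDiff_smoothBdd (g x)).differentiable_iteratedFDeriv
          (mod_cast ENat.natCast_lt_top k) η
      exact h1.hasFDerivAt.const_smul (φ x))
  refine h.congr_fderiv ?_
  set E' : (Rn n [×(k + 1)]→L[ℝ] ℂ) →L[ℝ] (Rn n →L[ℝ] Rn n [×k]→L[ℝ] ℂ) :=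
    E.toContinuousLinearEquiv.toContinuousLinearMap
  exact ContinuousLinearMap.integral_comp_comm (𝕜 := ℝ) (Fₗ := Rn n →L[ℝ] Rn n [×k]→L[ℝ] ℂ) E'
    ((hint.const_mul B).mono' (hmeas (k + 1) η)
      (Eventually.of_forall fun x => hbd (k + 1) B hB x η))

/-- The superposition `∫ φ(x) g_x dx` of elements of `𝓑` is an element of `𝓑`, and tight linear
forms commute with it. -/
theorem exists_superposition (hg : ∀ N, Continuous fun x => jet N (g x)) (hφ : Continuous φ)
    {ρ : Rn n → ℝ} (hρ : ∀ N, ∃ A : ℝ, 0 ≤ A ∧ ∀ x, ‖jet N (g x)‖ ≤ A * ρ x)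
    (hint : Integrable fun x => ‖φ x‖ * ρ x) :
    ∃ b : smoothBdd n, (∀ η, (b : Rn n → ℂ) η = ∫ x, φ x * (g x : Rn n → ℂ) η) ∧
      ∀ (N : ℕ) (U : smoothBdd n →ₗ[ℂ] ℂ), IsTight N U →
        Integrable (fun x => φ x * U (g x)) ∧ U b = ∫ x, φ x * U (g x) := by
  set p : Rn n → FormalMultilinearSeries ℝ (Rn n) ℂ := fun η k =>
    ∫ x, φ x • iteratedFDeriv ℝ k (g x : Rn n → ℂ) η with hp
  have hI := integrable_smul_jet hg hφ hρ hint
  have heval : ∀ (N : ℕ) (k : Fin (N + 1)) (η : Rn n),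
      (∫ x, φ x • jet N (g x)) η k = p η k := by
    intro N k η
    exact ((jetEval η k).integral_comp_comm (hI N)).symm
  have hz : ∀ η, (p η 0).curry0 = ∫ x, φ x * (g x : Rn n → ℂ) η := by
    intro η
    have h1 : Integrable fun x => φ x • iteratedFDeriv ℝ 0 (g x : Rn n → ℂ) η :=
      (jetEval η (0 : Fin 1)).integrable_comp (hI 0)
    exact ((ContinuousMultilinearMap.apply ℝ (fun _ : Fin 0 => Rn n) ℂ 0).integral_comp_comm
      h1).symm
  have hT : HasFTaylorSeriesUpTo ∞ (fun η => ∫ x, φ x * (g x : Rn n → ℂ) η) p := by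
    refine ⟨hz, fun k _ η => hasFDerivAt_integral_iteratedFDeriv hg hφ hρ hint k η,
      fun k _ => ?_⟩
    exact continuous_iff_continuousAt.2 fun η =>
      (hasFDerivAt_integral_iteratedFDeriv hg hφ hρ hint k η).continuousAt
  have hk : ∀ k η, iteratedFDeriv ℝ k (fun η => ∫ x, φ x * (g x : Rn n → ℂ) η) η = p η k :=
    fun k η => (hT.eq_iteratedFDeriv (mod_cast le_top) η).symm
  set b : smoothBdd n := ⟨fun η => ∫ x, φ x * (g x : Rn n → ℂ) η, hT.contDiff, fun k =>
    ⟨‖∫ x, φ x • jet k (g x)‖, fun η => by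
      rw [hk, ← heval k ⟨k, by lia⟩ η]
      exact (norm_le_pi_norm _ _).trans (BoundedContinuousFunction.norm_coe_le_norm _ _)⟩⟩
  refine ⟨b, fun η => rfl, fun N U hU => ?_⟩
  obtain ⟨V, hV⟩ := hU.exists_extension_jets
  -- The Taylor series found pointwise is the jet of the vector-valued integral, because point
  -- evaluations commute with that integral.
  have hb : jet N b = ∫ x, φ x • jet N (g x) := by
    ext η : 1
    funext k
    rw [heval]
    exact hk k η
  have he : ∀ x, V (φ x • jet N (g x)) = φ x * U (g x) := fun x => by
    rw [map_smul, hV, smul_eq_mul]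
  refine ⟨(V.integrable_comp (hI N)).congr (Eventually.of_forall he), ?_⟩
  rw [← hV, hb, ← V.integral_comp_comm (hI N)]
  exact integral_congr_ae (Eventually.of_forall he)

/-! ### Existence and uniqueness of the Poisson integral -/

lemma continuous_jet_poissonTest {n : ℕ} {α y : ℝ} (hα : -1 < α) (hy : 0 < y) (N : ℕ) :
    Continuous fun x : Rn n => jet N (poissonTest hα hy x) := by
  refine continuous_iff_continuousAt.2 fun x₀ => ?_
  obtain ⟨A, hA0, hA⟩ := exists_derivBound_poissonTest_sub n N hα hy (‖x₀‖ + 1)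
  rw [ContinuousAt, tendsto_iff_norm_sub_tendsto_zero]
  have h0 : Tendsto (fun x => A * ‖x - x₀‖) (𝓝 x₀) (𝓝 0) := by
    have : Continuous fun x => A * ‖x - x₀‖ := by fun_prop
    simpa using this.tendsto x₀
  refine squeeze_zero' (Eventually.of_forall fun x => norm_nonneg _) ?_ h0
  filter_upwards [continuous_norm.continuousAt.eventually_lt_const
    (show ‖x₀‖ < ‖x₀‖ + 1 by linarith)] with x hx
  rw [← map_sub]
  exact (norm_jet_le_iff (by positivity)).2 (hA x x₀ hx.le (by linarith))

lemma exists_norm_jet_poissonTest_le {n : ℕ} {α y : ℝ} (hα : -1 < α) (hy : 0 < y) (N : ℕ) :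
    ∃ A : ℝ, 0 ≤ A ∧ ∀ x : Rn n,
      ‖jet N (poissonTest hα hy x)‖ ≤ A * weight (α + n + 1) x := by
  obtain ⟨A, hA0, hA⟩ := exists_derivBound_poissonTest n N hα hy
  exact ⟨A, hA0, fun x =>
    (norm_jet_le_iff (mul_nonneg hA0 (weight_pos _ x).le)).2 (hA x)⟩

lemma integrable_norm_schwartz_mul_weight {n : ℕ} (φ : 𝓢(Rn n, ℂ)) (μ : ℝ) :
    Integrable fun x => ‖φ x‖ * weight μ x := by
  have h := (SchwartzMap.smulLeftCLM ℂ (fun x : Rn n => (weight μ x : ℂ)) φ).integrable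
    (μ := volume) |>.norm
  refine h.congr (Eventually.of_forall fun x => ?_)
  simp only
  rw [SchwartzMap.smulLeftCLM_apply_apply (weight_hasTemperateGrowth μ), norm_smul,
    Complex.norm_real, Real.norm_of_nonneg (weight_pos μ x).le, mul_comm]

lemma reflConv_kernelDistribution {n : ℕ} {α y : ℝ} (hy : 0 < y) (φ : 𝓢(Rn n, ℂ)) (η : Rn n) :
    reflConv (kernelDistribution α hy) φ η = ∫ x, φ x * (kernel α (η - x) y : ℂ) := by
  have h : reflConv (kernelDistribution α hy) φ η =
      ∫ x, shift η φ x • (kernel α x y : ℂ) := rfl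
  rw [h, ← integral_sub_right_eq_self (μ := volume) _ η]
  refine integral_congr_ae (Eventually.of_forall fun x => ?_)
  simp only [shift_apply, sub_add_cancel, smul_eq_mul]
  rw [kernel, kernel, norm_sub_rev]

lemma hasTemperateGrowth_smoothBdd {n : ℕ} (b : smoothBdd n) :
    (b : Rn n → ℂ).HasTemperateGrowth :=
  ⟨b.2.1, fun k => let ⟨C, hC⟩ := b.2.2 k; ⟨0, C, fun x => by simpa using hC x⟩⟩

/-- A continuous function of polynomial growth is a tempered distribution. -/
lemma exists_isGivenBy {n : ℕ} {G : Rn n → ℂ} (hG : Continuous G) {A μ : ℝ}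
    (h : ∀ x, ‖G x‖ ≤ A * weight μ x) :
    ∃ g : 𝓢'(Rn n, ℂ), ∀ φ : 𝓢(Rn n, ℂ), g φ = ∫ x, φ x * G x := by
  -- Dividing by the weight gives an L^∞ function, which is a tempered distribution; the weight is
  -- then multiplied back.
  have hc : Continuous fun x => (weight (-μ) x : ℂ) * G x :=
    (weight_hasTemperateGrowth (-μ)).1.continuous.mul hG
  have hm : MemLp (fun x => (weight (-μ) x : ℂ) * G x) ⊤ volume :=
    memLp_top_of_bound hc.aestronglyMeasurable A (Eventually.of_forall fun x => by
      have h1 := weight_mul_weight_neg μ x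
      have h2 := weight_pos (-μ) x
      rw [norm_mul, Complex.norm_real, Real.norm_of_nonneg h2.le]
      calc _ ≤ weight (-μ) x * (A * weight μ x) := mul_le_mul_of_nonneg_left (h x) h2.le
        _ = A := by linear_combination A * h1)
  refine ⟨TemperedDistribution.smulLeftCLM ℂ (fun x => (weight μ x : ℂ))
    (hm.toLp _ : Lp ℂ ⊤ (volume : Measure (Rn n))), fun φ => ?_⟩
  rw [TemperedDistribution.smulLeftCLM_apply_apply, Lp.toTemperedDistribution_apply]
  refine integral_congr_ae ?_
  filter_upwards [hm.coeFn_toLp] with x hx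
  rw [hx, SchwartzMap.smulLeftCLM_apply_apply (weight_hasTemperateGrowth μ), smul_eq_mul,
    smul_eq_mul]
  have h1 : (weight μ x : ℂ) * (weight (-μ) x : ℂ) = 1 := by
    rw [← Complex.ofReal_mul, weight_mul_weight_neg, Complex.ofReal_one]
  linear_combination φ x * G x * h1

/-- The Poisson integral in terms of the extension `U` of `w^{-(α+n+1)} f` to `𝓑`. -/
def poissonValue {n : ℕ} (U : smoothBdd n →ₗ[ℂ] ℂ) {α : ℝ} (hα : -1 < α) (x : Rn n) (y : ℝ) : ℂ :=
  if hy : 0 < y then U (poissonTest hα hy x) else 0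

lemma poissonValue_eq {n : ℕ} (U : smoothBdd n →ₗ[ℂ] ℂ) {α : ℝ} (hα : -1 < α) (x : Rn n) {y : ℝ}
    (hy : 0 < y) : poissonValue U hα x y = U (poissonTest hα hy x) := dif_pos hy

/-- The reflected convolution of the kernel with φ is w^{-μ} b_φ, where b_φ ∈ 𝓑 superposes the test
functions. So its product with f extends to the tight form U(b_φ ·), whose value at 1 is U(b_φ) = ∫
φ U(`poissonTest`). -/
theorem isPoissonIntegral_poissonValue {n N : ℕ} {f : 𝓢'(Rn n, ℂ)} {α : ℝ} (hα : -1 < α)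
    {U : smoothBdd n →ₗ[ℂ] ℂ} (hU : IsTight N U)
    (hUf : ∀ φ : 𝓢(Rn n, ℂ), U (schwartzToBdd φ) =
      TemperedDistribution.smulLeftCLM ℂ (fun x : Rn n => (weight (-(α + n + 1)) x : ℂ)) f φ) :
    IsPoissonIntegral α f (poissonValue U hα) := by
  intro y hy
  set μ : ℝ := α + n + 1
  have hF : (fun x : Rn n => poissonValue U hα x y) = fun x => U (poissonTest hα hy x) :=
    funext fun x => poissonValue_eq U hα x hy
  rw [hF]
  obtain ⟨V, hV⟩ := hU.exists_extension_jets
  have hcont : Continuous fun x : Rn n => U (poissonTest hα hy x) := by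
    simp_rw [← hV]
    exact V.continuous.comp (continuous_jet_poissonTest hα hy N)
  refine ⟨hcont, ?_⟩
  have hsup := fun φ : 𝓢(Rn n, ℂ) => exists_superposition (continuous_jet_poissonTest hα hy)
    φ.continuous (exists_norm_jet_poissonTest_le (n := n) hα hy)
    (integrable_norm_schwartz_mul_weight φ _)
  choose b hb hbU using hsup
  obtain ⟨g, hg⟩ : ∃ g : 𝓢'(Rn n, ℂ), ∀ φ : 𝓢(Rn n, ℂ),
      g φ = ∫ x, φ x * U (poissonTest hα hy x) := by
    obtain ⟨C, hC0, hC⟩ := hU.bound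
    obtain ⟨A, hA0, hA⟩ := exists_derivBound_poissonTest n N hα hy
    refine exists_isGivenBy hcont (A := C * A) (μ := μ) fun x => (hC _ _ (hA x)).trans_eq ?_
    rw [mul_assoc]
  have hrefl : ∀ φ, reflConv (kernelDistribution α hy) φ =
      (fun x : Rn n => (weight (-μ) x : ℂ)) * (b φ : Rn n → ℂ) := by
    intro φ
    funext η
    have h1 : (weight (-μ) η : ℂ) * (weight μ η : ℂ) = 1 := by
      rw [← Complex.ofReal_mul, mul_comm, weight_mul_weight_neg, Complex.ofReal_one]
    rw [reflConv_kernelDistribution, Pi.mul_apply, hb, ← integral_const_mul]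
    refine integral_congr_ae (Eventually.of_forall fun x => ?_)
    simp only [poissonTest_apply]
    linear_combination -φ x * (kernel α (η - x) y : ℂ) * h1
  have hrestr : ∀ φ ψ : 𝓢(Rn n, ℂ), (U ∘ₗ mulBddLM (b φ)) (schwartzToBdd ψ) =
      TemperedDistribution.smulLeftCLM ℂ (reflConv (kernelDistribution α hy) φ) f ψ := by
    intro φ ψ
    have hbt := hasTemperateGrowth_smoothBdd (b φ)
    have e : mulBdd (b φ) (schwartzToBdd ψ) =
        schwartzToBdd (SchwartzMap.smulLeftCLM ℂ (b φ : Rn n → ℂ) ψ) := by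
      refine Subtype.ext (funext fun x => ?_)
      change _ = SchwartzMap.smulLeftCLM ℂ (b φ : Rn n → ℂ) ψ x
      rw [SchwartzMap.smulLeftCLM_apply_apply hbt]
      rfl
    rw [LinearMap.comp_apply, mulBddLM_apply, e, hUf,
      TemperedDistribution.smulLeftCLM_apply_apply, TemperedDistribution.smulLeftCLM_apply_apply,
      SchwartzMap.smulLeftCLM_smulLeftCLM_apply (weight_hasTemperateGrowth _) hbt, hrefl]
  refine ⟨g, ⟨fun φ => (hU.comp_mulBdd (b φ)).isIntegrableDistribution (hrestr φ), fun φ => ?_⟩,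
    fun φ => ⟨(hbU φ N U hU).1, hg φ⟩⟩
  have h1 := (hU.comp_mulBdd (b φ)).hasIntegral (hrestr φ)
  have e : mulBdd (b φ) (oneBdd n) = b φ := Subtype.ext (funext fun x => mul_one _)
  rw [LinearMap.comp_apply, mulBddLM_apply, e, (hbU φ N U hU).2, ← hg] at h1
  exact h1

lemma eq_of_forall_integral_schwartz_eq {n : ℕ} {F G : Rn n → ℂ} (hF : Continuous F)
    (hG : Continuous G) (h : ∀ φ : 𝓢(Rn n, ℂ), ∫ x, φ x * F x = ∫ x, φ x * G x) : F = G := by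
  refine (hF.ae_eq_iff_eq volume hG).1 ?_
  refine ae_eq_of_integral_contDiff_smul_eq hF.locallyIntegrable hG.locallyIntegrable
    fun g hg hgc => ?_
  have hgc' : HasCompactSupport fun x => (g x : ℂ) := hgc.comp_left (g := Complex.ofReal) rfl
  have h1 := h (hgc'.toSchwartzMap (Complex.ofRealCLM.contDiff.comp hg))
  simp_rw [Complex.real_smul]
  exact h1

lemma IsPoissonIntegral.unique {n : ℕ} {α : ℝ} {f : 𝓢'(Rn n, ℂ)} {F G : Rn n → ℝ → ℂ}
    (hF : IsPoissonIntegral α f F) (hG : IsPoissonIntegral α f G) (x : Rn n) {y : ℝ} (hy : 0 < y) :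
    F x y = G x y := by
  obtain ⟨hFc, g, hg, hgF⟩ := hF y hy
  obtain ⟨hGc, g', hg', hgG⟩ := hG y hy
  refine congrFun (eq_of_forall_integral_schwartz_eq hFc hGc fun φ => ?_) x
  rw [← (hgF φ).2, ← (hgG φ).2]
  exact (hg.2 φ).unique (hg'.2 φ)

/-! ### Growth of the Poisson integral -/

/-- This is the source of m: it is extracted from f alone, before any α enters. -/
lemma exists_schwartz_bound {n : ℕ} (f : 𝓢'(Rn n, ℂ)) :
    ∃ (m : ℕ) (C : ℝ), 0 ≤ C ∧ ∀ (φ : 𝓢(Rn n, ℂ)) (B : ℝ), 0 ≤ B →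
      (∀ k ≤ m, ∀ l ≤ m, ∀ x, ‖x‖ ^ k * ‖iteratedFDeriv ℝ l (φ : Rn n → ℂ) x‖ ≤ B) →
        ‖f φ‖ ≤ C * B := by
  have hc : Continuous f := map_continuous f
  obtain ⟨s, C, -, hC⟩ := Seminorm.bound_of_continuous (schwartz_withSeminorms ℂ (Rn n) ℂ)
    ((normSeminorm ℂ ℂ).comp (f : 𝓢(Rn n, ℂ) →ₗ[ℂ] ℂ)) hc.norm
  refine ⟨s.sup (fun i => max i.1 i.2), C, C.2, fun φ B hB h => ?_⟩
  refine (hC φ).trans ?_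
  rw [_root_.smul_apply]
  refine mul_le_mul_of_nonneg_left (Seminorm.finset_sup_apply_le hB fun i hi => ?_) C.2
  have h1 : max i.1 i.2 ≤ s.sup (fun i => max i.1 i.2) :=
    Finset.le_sup (f := fun i : ℕ × ℕ => max i.1 i.2) hi
  exact SchwartzMap.seminorm_le_bound ℂ _ _ _ hB
    (h i.1 ((le_max_left _ _).trans h1) i.2 ((le_max_right _ _).trans h1))

/-- With |η - x|² + y² ≥ 1 the extra decay of kernel derivatives can be dropped. The comparison
factor a is left free: it becomes D/r², 3(r/y)² or 5 according to the region. -/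
lemma exists_norm_iteratedFDeriv_poissonTest_le (n N : ℕ) {α : ℝ} (hα : -1 < α) :
    ∃ C : ℝ, 0 ≤ C ∧ ∀ (y : ℝ) (hy : 0 < y) (x η : Rn n) (a : ℝ), 0 ≤ a →
      1 ≤ ‖η - x‖ ^ 2 + y ^ 2 → 1 + ‖η‖ ^ 2 ≤ a * (‖η - x‖ ^ 2 + y ^ 2) → ∀ k ≤ N,
        ‖iteratedFDeriv ℝ k (poissonTest hα hy x : Rn n → ℂ) η‖ ≤
          C * (y ^ (α + 1) * a ^ ((α + n + 1) / 2)) := by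
  obtain ⟨C, hC0, hC⟩ := exists_norm_iteratedFDeriv_weight_le n N (α + n + 1)
  obtain ⟨D, hD0, hD⟩ := exists_norm_iteratedFDeriv_kernel_le n N α
  have hn : (0 : ℝ) ≤ n := by positivity
  refine ⟨2 ^ N * C * D, by positivity, fun y hy x η a ha hq1 hq k hk => ?_⟩
  set q : ℝ := ‖η - x‖ ^ 2 + y ^ 2
  have hq0 : 0 < q := by positivity
  have hw := weight_pos (α + n + 1) η
  have h1 : ∀ k ≤ N, ‖iteratedFDeriv ℝ k (fun η : Rn n => (kernel α (η - x) y : ℂ)) η‖ ≤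
      D * (y ^ (α + 1) * q ^ (-(α + n + 1) / 2)) := fun k hk => by
    rw [iteratedFDeriv_kernel_sub]
    refine (hD k hk y hy (η - x)).trans ?_
    have hk0 : (0 : ℝ) ≤ k := by positivity
    have : q ^ (-(α + n + 1 + k) / 2) ≤ q ^ (-(α + n + 1) / 2) :=
      Real.rpow_le_rpow_of_exponent_le hq1 (by linarith)
    gcongr
  refine (norm_iteratedFDeriv_mul_le_of_le (weight_hasTemperateGrowth (α + n + 1)).1
    (contDiff_kernel_sub α hy x) (fun k hk => hC k hk η) h1 hk).trans ?_
  have h2 := rpow_mul_rpow_neg_le (μ := α + n + 1) ha (by positivity) hq0 (by linarith) hq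
  calc 2 ^ N * (C * weight (α + n + 1) η * (D * (y ^ (α + 1) * q ^ (-(α + n + 1) / 2)))) =
        2 ^ N * C * D * (y ^ (α + 1) * ((1 + ‖η‖ ^ 2) ^ ((α + n + 1) / 2) *
          q ^ (-(α + n + 1) / 2))) := by
        rw [weight]
        ring
    _ ≤ _ := by gcongr

lemma mulBdd_cutoff_add {n : ℕ} {R : ℝ} (hR : 1 ≤ R) (ψ : smoothBdd n) :
    ψ = mulBdd (cutoffBdd R hR) ψ + mulBdd (oneBdd n - cutoffBdd R hR) ψ := by
  ext x
  change _ = cutoff R x * _ + (1 - cutoff R x) * _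
  ring

lemma rpow_sq_div_le {α y r D : ℝ} (n : ℕ) (hα : -1 < α) (hy : 0 < y) (hr : 1 ≤ r) (hyr : y ≤ r)
    (hD : 0 ≤ D) :
    y ^ (α + 1) * (D * (r⁻¹) ^ 2) ^ ((α + n + 1) / 2) ≤ D ^ ((α + n + 1) / 2) := by
  have hr0 : 0 < r := by linarith
  have h1 : ((r⁻¹) ^ 2) ^ ((α + n + 1) / 2) = (r ^ (α + 1))⁻¹ * (r ^ n)⁻¹ := by
    rw [← Real.rpow_natCast, ← Real.rpow_mul (by positivity), ← mul_inv, ← Real.rpow_natCast r n,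
      ← Real.rpow_add hr0, Real.inv_rpow hr0.le]
    congr 2
    push_cast
    ring
  have h2 : y ^ (α + 1) ≤ r ^ (α + 1) := Real.rpow_le_rpow hy.le hyr (by linarith)
  have h3 : (r ^ n)⁻¹ ≤ 1 := inv_le_one_of_one_le₀ (one_le_pow₀ hr)
  rw [Real.mul_rpow hD (by positivity), h1]
  calc _ ≤ r ^ (α + 1) * (D ^ ((α + n + 1) / 2) * ((r ^ (α + 1))⁻¹ * 1)) := by gcongr
    _ = D ^ ((α + n + 1) / 2) := by
      have : r ^ (α + 1) ≠ 0 := by positivity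
      field_simp

/-- For a = 3(r/y)² the powers of y leave r^{α+1} (r/y)^n, and (r/y)^n is what cos^n ϑ cancels. -/
lemma rpow_mul_sq_div {α y r : ℝ} (n : ℕ) (hy : 0 < y) (hr : 0 < r) :
    y ^ (α + 1) * (3 * (r / y) ^ 2) ^ ((α + n + 1) / 2) =
      3 ^ ((α + n + 1) / 2) * (r ^ (α + 1) * (r / y) ^ n) := by
  have h1 : ((r / y) ^ 2) ^ ((α + n + 1) / 2) = (r ^ (α + 1) / y ^ (α + 1)) * (r / y) ^ n := by
    rw [← Real.rpow_natCast, ← Real.rpow_mul (by positivity), ← Real.rpow_natCast _ n,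
      ← Real.div_rpow hr.le hy.le, ← Real.rpow_add (by positivity)]
    congr 1
    push_cast
    ring
  rw [Real.mul_rpow (by norm_num) (by positivity), h1]
  have : y ^ (α + 1) ≠ 0 := by positivity
  field_simp

/-- The Poisson integral at height at least `1`. -/
lemma exists_bound_of_one_le {n N : ℕ} {α : ℝ} (hα : -1 < α) {U : smoothBdd n →ₗ[ℂ] ℂ}
    (hU : IsTight N U) {ε : ℝ} (hε : 0 < ε) :
    ∃ r₀ B : ℝ, ∀ (r : ℝ) (x : Rn n) (y : ℝ) (hy : 0 < y), r₀ ≤ r → 1 ≤ y →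
      ‖x‖ ^ 2 + y ^ 2 = r ^ 2 →
        ‖U (poissonTest hα hy x)‖ * (y / r) ^ n ≤ ε * r ^ (α + 1) + B := by
  obtain ⟨CU, hCU0, hCU⟩ := hU.bound
  obtain ⟨K, hK0, hK⟩ := exists_derivBound_cutoff n N
  obtain ⟨L, hL0, hL⟩ := exists_derivBound_one_sub_cutoff n N
  obtain ⟨C, hC0, hC⟩ := exists_norm_iteratedFDeriv_poissonTest_le n N hα
  set T : ℝ := 2 ^ N * (L * (C * 3 ^ ((α + n + 1) / 2))) with hT
  have hT0 : 0 ≤ T := by positivity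
  obtain ⟨R', hR'⟩ := hU.tail (ε / (T + 1)) (by positivity)
  set R : ℝ := max R' 1
  have hR1 : 1 ≤ R := le_max_right _ _
  have hR0 : 0 < R := by linarith
  set D : ℝ := 4 * (1 + (2 * R) ^ 2) with hD
  have hD0 : 0 ≤ D := by positivity
  set B : ℝ := CU * (2 ^ N * (K * (C * D ^ ((α + n + 1) / 2))))
  have hB0 : 0 ≤ B := by positivity
  -- For r ≥ 4R and |η| ≤ 2R one has r² ≤ 4(|η - x|² + y²), whence the 4 in D.
  refine ⟨4 * R, B, fun r x y hy hr hy1 hxy => ?_⟩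
  have hr1 : 1 ≤ r := by linarith
  have hr0 : 0 < r := by linarith
  have hyr : y ≤ r := by
    refine (sq_le_sq₀ hy.le hr0.le).1 ?_
    nlinarith [sq_nonneg ‖x‖]
  have hnear : ‖U (mulBdd (cutoffBdd R hR1) (poissonTest hα hy x))‖ ≤ B := by
    refine hCU _ _ (derivBound_cutoff_mul hR0 (hK R hR1) (contDiff_smoothBdd _)
      fun k hk η hη => ?_)
    refine (hC y hy x η (D * (r⁻¹) ^ 2) (by positivity) ?_ ?_ k hk).trans
      (mul_le_mul_of_nonneg_left (rpow_sq_div_le n hα hy hr1 hyr hD0) hC0)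
    · nlinarith [sq_nonneg ‖η - x‖]
    · have h1 : ‖x‖ ^ 2 ≤ 2 * ‖η - x‖ ^ 2 + 2 * ‖η‖ ^ 2 := by
        have h2 : ‖x‖ ≤ ‖η - x‖ + ‖η‖ := by
          have := norm_sub_le η (η - x)
          rw [sub_sub_cancel] at this
          linarith
        nlinarith [sq_nonneg (‖η - x‖ - ‖η‖), norm_nonneg x, norm_nonneg (η - x), norm_nonneg η]
      have h3 : ‖η‖ ^ 2 ≤ (2 * R) ^ 2 := by gcongr
      have h4 : r ^ 2 ≤ 4 * (‖η - x‖ ^ 2 + y ^ 2) := by nlinarith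
      have h5 : r⁻¹ ^ 2 * r ^ 2 = 1 := by
        rw [← mul_pow, inv_mul_cancel₀ hr0.ne', one_pow]
      calc 1 + ‖η‖ ^ 2 ≤ (1 + (2 * R) ^ 2) * (r⁻¹ ^ 2 * r ^ 2) := by
            rw [h5, mul_one]
            linarith
        _ ≤ (1 + (2 * R) ^ 2) * (r⁻¹ ^ 2 * (4 * (‖η - x‖ ^ 2 + y ^ 2))) := by gcongr
        _ = _ := by
          rw [hD]
          ring
  have hfar : ‖U (mulBdd (oneBdd n - cutoffBdd R hR1) (poissonTest hα hy x))‖ ≤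
      ε * (r ^ (α + 1) * (r / y) ^ n) := by
    have hd : ∀ k ≤ N, ∀ η : Rn n, R ≤ ‖η‖ →
        ‖iteratedFDeriv ℝ k (poissonTest hα hy x : Rn n → ℂ) η‖ ≤
          C * (y ^ (α + 1) * (3 * (r / y) ^ 2) ^ ((α + n + 1) / 2)) := by
      intro k hk η _
      refine hC y hy x η _ (by positivity) (by nlinarith [sq_nonneg ‖η - x‖]) ?_ k hk
      have e : 3 * (r / y) ^ 2 * (‖η - x‖ ^ 2 + y ^ 2) =
          3 * (r ^ 2 / y ^ 2 * ‖η - x‖ ^ 2) + 3 * r ^ 2 := by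
        field_simp
      rw [e]
      have h7 : ‖η - x‖ ^ 2 ≤ r ^ 2 / y ^ 2 * ‖η - x‖ ^ 2 := by
        refine le_mul_of_one_le_left (sq_nonneg _) ?_
        rw [one_le_div (by positivity)]
        gcongr
      nlinarith [one_add_norm_sq_le x η, sq_nonneg ‖η - x‖]
    have hz : ∀ η : Rn n, ‖η‖ < R' → (mulBdd (oneBdd n - cutoffBdd R hR1)
        (poissonTest hα hy x) : Rn n → ℂ) η = 0 := by
      intro η hη
      change (1 - cutoff R η) * _ = 0
      rw [cutoff_eq_one hR0 (hη.le.trans (le_max_left _ _)), sub_self, zero_mul]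
    have h := hR' (mulBdd (oneBdd n - cutoffBdd R hR1) (poissonTest hα hy x)) _ hz
      (derivBound_one_sub_cutoff_mul hR0 (hL R hR1) (contDiff_smoothBdd (poissonTest hα hy x))
        (by positivity) hd)
    refine h.trans ?_
    rw [rpow_mul_sq_div n hy hr0]
    have e : 2 ^ N * (L * (C * (3 ^ ((α + n + 1) / 2) * (r ^ (α + 1) * (r / y) ^ n)))) =
        T * (r ^ (α + 1) * (r / y) ^ n) := by
      rw [hT]
      ring
    rw [e, div_mul_eq_mul_div, div_le_iff₀ (by positivity)]
    have h6 : 0 ≤ ε * (r ^ (α + 1) * (r / y) ^ n) := by positivity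
    nlinarith
  have h0 : ‖U (poissonTest hα hy x)‖ ≤ ε * (r ^ (α + 1) * (r / y) ^ n) + B := by
    conv_lhs => rw [mulBdd_cutoff_add hR1 (poissonTest hα hy x), map_add]
    exact (norm_add_le _ _).trans (by linarith)
  have hp : (y / r) ^ n ≤ 1 := pow_le_one₀ (by positivity) ((div_le_one hr0).2 hyr)
  have hp0 : 0 ≤ (y / r) ^ n := by positivity
  have hq : (r / y) ^ n * (y / r) ^ n = 1 := by
    rw [← mul_pow, div_mul_div_cancel₀ hy.ne', div_self hr0.ne', one_pow]
  calc _ ≤ (ε * (r ^ (α + 1) * (r / y) ^ n) + B) * (y / r) ^ n := by gcongr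
    _ = ε * r ^ (α + 1) * ((r / y) ^ n * (y / r) ^ n) + B * (y / r) ^ n := by ring
    _ ≤ ε * r ^ (α + 1) * 1 + B * 1 := by
      rw [hq]
      gcongr
    _ = _ := by ring

/-- The Poisson integral at height less than `1`. -/
lemma exists_bound_of_lt_one {n N m : ℕ} {f : 𝓢'(Rn n, ℂ)} {α Cf : ℝ} (hα : -1 < α)
    {U : smoothBdd n →ₗ[ℂ] ℂ} (hU : IsTight N U)
    (hUf : ∀ φ : 𝓢(Rn n, ℂ), U (schwartzToBdd φ) =
      TemperedDistribution.smulLeftCLM ℂ (fun x : Rn n => (weight (-(α + n + 1)) x : ℂ)) f φ)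
    (hCf0 : 0 ≤ Cf) (hf : ∀ (φ : 𝓢(Rn n, ℂ)) (B : ℝ), 0 ≤ B →
      (∀ k ≤ m, ∀ l ≤ m, ∀ x, ‖x‖ ^ k * ‖iteratedFDeriv ℝ l (φ : Rn n → ℂ) x‖ ≤ B) →
        ‖f φ‖ ≤ Cf * B) :
    ∃ B : ℝ, ∀ (r : ℝ) (x : Rn n) (y : ℝ) (hy : 0 < y), 1 ≤ r → y < 1 →
      ‖x‖ ^ 2 + y ^ 2 = r ^ 2 → ‖U (poissonTest hα hy x)‖ * (y / r) ^ (n + m) ≤ B := by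
  obtain ⟨CU, hCU0, hCU⟩ := hU.bound
  obtain ⟨K, hK0, hK⟩ := exists_derivBound_cutoff n m
  obtain ⟨L, hL0, hL⟩ := exists_derivBound_one_sub_cutoff n N
  obtain ⟨C, hC0, hC⟩ := exists_norm_iteratedFDeriv_poissonTest_le n N hα
  obtain ⟨D, hD0, hD⟩ := exists_norm_iteratedFDeriv_kernel_le n m α
  set B₁ : ℝ := CU * (2 ^ N * (L * (C * 5 ^ ((α + n + 1) / 2))))
  have hB₁ : 0 ≤ B₁ := by positivity
  refine ⟨Cf * (4 ^ m * (2 ^ m * (K * D))) + B₁, fun r x y hy hr hy1 hxy => ?_⟩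
  have hr0 : 0 < r := by linarith
  have hR0 : 0 < 2 * r := by linarith
  have hR1 : 1 ≤ 2 * r := by linarith
  have hyr : y ≤ r := by linarith
  have hxr : ‖x‖ ≤ r := by
    refine (sq_le_sq₀ (norm_nonneg x) hr0.le).1 ?_
    nlinarith [sq_nonneg y]
  have hfar : ‖U (mulBdd (oneBdd n - cutoffBdd (2 * r) hR1) (poissonTest hα hy x))‖ ≤ B₁ := by
    refine hCU _ _ (derivBound_one_sub_cutoff_mul hR0 (hL _ hR1)
      (contDiff_smoothBdd (poissonTest hα hy x)) (by positivity) fun k hk η hη => ?_)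
    have h1 : ‖η‖ ≤ 2 * ‖η - x‖ := by
      have := norm_add_le (η - x) x
      rw [sub_add_cancel] at this
      linarith
    have h2 : 1 ≤ ‖η - x‖ := by linarith
    -- Here |η| ≤ 2|η - x| and 1 ≤ |η - x|, so 1 + |η|² ≤ 5|η - x|².
    refine (hC y hy x η 5 (by norm_num) (by nlinarith [sq_nonneg y])
      (by nlinarith [sq_nonneg y, norm_nonneg η]) k hk).trans ?_
    have h3 : y ^ (α + 1) ≤ 1 := Real.rpow_le_one hy.le hy1.le (by linarith)
    calc _ ≤ C * (1 * 5 ^ ((α + n + 1) / 2)) := by gcongr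
      _ = _ := by ring
  -- On compactly supported functions U is w^{-μ} f; the weights cancel, the bare kernel remains,
  -- and the order m of f replaces the order N of U.
  have hnear : ‖U (mulBdd (cutoffBdd (2 * r) hR1) (poissonTest hα hy x))‖ ≤
      Cf * ((4 * r) ^ m * (2 ^ m * (K * (D * (y ^ (n + m))⁻¹)))) := by
    have e1 : mulBdd (cutoffBdd (2 * r) hR1) (poissonTest hα hy x) =
        schwartzToBdd (cutoffMul hR0 (poissonTest hα hy x)) := rfl
    rw [e1, hUf, TemperedDistribution.smulLeftCLM_apply_apply]
    refine hf _ _ (by positivity) fun k hk l hl η => ?_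
    have e2 : (SchwartzMap.smulLeftCLM ℂ (fun x : Rn n => (weight (-(α + n + 1)) x : ℂ))
        (cutoffMul hR0 (poissonTest hα hy x)) : Rn n → ℂ) =
        fun η => cutoff (2 * r) η * (kernel α (η - x) y : ℂ) := by
      funext η
      have h1 : (weight (α + n + 1) η : ℂ) * (weight (-(α + n + 1)) η : ℂ) = 1 := by
        rw [← Complex.ofReal_mul, weight_mul_weight_neg, Complex.ofReal_one]
      rw [SchwartzMap.smulLeftCLM_apply_apply (weight_hasTemperateGrowth _), cutoffMul_apply,
        poissonTest_apply, smul_eq_mul]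
      linear_combination cutoff (2 * r) η * (kernel α (η - x) y : ℂ) * h1
    rw [e2]
    have h1 := derivBound_cutoff_mul hR0 (hK _ hR1) (contDiff_kernel_sub α hy x)
      (b := D * (y ^ (n + m))⁻¹) (fun l hl η _ => by
        rw [iteratedFDeriv_kernel_sub]
        refine (hD l hl y hy _).trans (mul_le_mul_of_nonneg_left ?_ hD0)
        have hl0 : (0 : ℝ) ≤ l := by positivity
        have hn0 : (0 : ℝ) ≤ n := by positivity
        have hlm : (l : ℝ) ≤ m := by exact_mod_cast hl
        -- The worst point is η = x, where order l costs y^{-(n+l)}; as y < 1 this is at most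
        -- y^{-(n+m)}.
        calc _ ≤ y ^ (α + 1) * (y ^ 2) ^ (-(α + n + 1 + l) / 2) := by
              refine mul_le_mul_of_nonneg_left (Real.rpow_le_rpow_of_nonpos (by positivity)
                (by nlinarith [sq_nonneg ‖η - x‖]) (by linarith)) (by positivity)
          _ = y ^ (-((n : ℝ) + l)) := by
              rw [← Real.rpow_natCast, ← Real.rpow_mul hy.le, ← Real.rpow_add hy]
              congr 1
              push_cast
              ring
          _ ≤ y ^ (-((n : ℝ) + m)) :=
              Real.rpow_le_rpow_of_exponent_ge hy hy1.le (by linarith)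
          _ = _ := by
              rw [Real.rpow_neg hy.le]
              congr 1
              exact_mod_cast Real.rpow_natCast y (n + m))
    by_cases hη : ‖η‖ ≤ 4 * r
    · refine mul_le_mul ?_ (h1 l hl η) (norm_nonneg _) (by positivity)
      calc ‖η‖ ^ k ≤ (4 * r) ^ k := by gcongr
        _ ≤ (4 * r) ^ m := pow_le_pow_right₀ (by linarith) hk
    · have h2 : (fun η => cutoff (2 * r) η * (kernel α (η - x) y : ℂ)) =ᶠ[𝓝 η] fun _ => 0 := by
        filter_upwards [continuous_norm.continuousAt.eventually_const_lt (not_le.1 hη)] with z hz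
        rw [cutoff_eq_zero hR0 (by linarith), zero_mul]
      rw [(h2.iteratedFDeriv ℝ l).eq_of_nhds, iteratedFDeriv_fun_zero]
      simp only [Pi.zero_apply, norm_zero, mul_zero]
      positivity
  have h0 : ‖U (poissonTest hα hy x)‖ ≤
      Cf * ((4 * r) ^ m * (2 ^ m * (K * (D * (y ^ (n + m))⁻¹)))) + B₁ := by
    conv_lhs => rw [mulBdd_cutoff_add hR1 (poissonTest hα hy x), map_add]
    exact (norm_add_le _ _).trans (add_le_add hnear hfar)
  have hp : (y / r) ^ (n + m) ≤ 1 := pow_le_one₀ (by positivity) ((div_le_one hr0).2 hyr)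
  have hrn : (r ^ n)⁻¹ ≤ 1 := inv_le_one_of_one_le₀ (one_le_pow₀ hr)
  calc _ ≤ (Cf * ((4 * r) ^ m * (2 ^ m * (K * (D * (y ^ (n + m))⁻¹)))) + B₁) *
        (y / r) ^ (n + m) := by gcongr
    -- r^m y^{-(n+m)} (y/r)^{n+m} = r^{-n}: the exponent n + m exactly compensates the powers of
    -- 1/y.
    _ = Cf * (4 ^ m * (2 ^ m * (K * D))) * (r ^ n)⁻¹ + B₁ * (y / r) ^ (n + m) := by
      rw [add_mul, mul_pow, div_pow, pow_add r n m]
      have hy0 : y ^ (n + m) ≠ 0 := by positivity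
      field_simp
    _ ≤ Cf * (4 ^ m * (2 ^ m * (K * D))) * 1 + B₁ * 1 := by gcongr
    _ = _ := by ring

lemma exists_growth_bound {n N m : ℕ} {f : 𝓢'(Rn n, ℂ)} {α Cf : ℝ} (hα : -1 < α)
    {U : smoothBdd n →ₗ[ℂ] ℂ} (hU : IsTight N U)
    (hUf : ∀ φ : 𝓢(Rn n, ℂ), U (schwartzToBdd φ) =
      TemperedDistribution.smulLeftCLM ℂ (fun x : Rn n => (weight (-(α + n + 1)) x : ℂ)) f φ)
    (hCf0 : 0 ≤ Cf) (hf : ∀ (φ : 𝓢(Rn n, ℂ)) (B : ℝ), 0 ≤ B →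
      (∀ k ≤ m, ∀ l ≤ m, ∀ x, ‖x‖ ^ k * ‖iteratedFDeriv ℝ l (φ : Rn n → ℂ) x‖ ≤ B) →
        ‖f φ‖ ≤ Cf * B) {ε : ℝ} (hε : 0 < ε) :
    ∀ᶠ r : ℝ in atTop, ∀ (x : Rn n) (y : ℝ) (hy : 0 < y), ‖x‖ ^ 2 + y ^ 2 = r ^ 2 →
      ‖U (poissonTest hα hy x)‖ * (y / r) ^ (n + m) ≤ ε * r ^ (α + 1) := by
  obtain ⟨r₀, B, hB⟩ := exists_bound_of_one_le hα hU (half_pos hε)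
  obtain ⟨B', hB'⟩ := exists_bound_of_lt_one hα hU hUf hCf0 hf
  have hlim : Tendsto (fun r : ℝ => r ^ (α + 1)) atTop atTop :=
    tendsto_rpow_atTop (by linarith)
  filter_upwards [eventually_ge_atTop r₀, eventually_ge_atTop 1,
    hlim.eventually_ge_atTop (max B B' / (ε / 2))] with r hr hr1 hrB x y hy hxy
  have hr0 : 0 < r := by linarith
  rw [div_le_iff₀ (by positivity)] at hrB
  have h1 : 0 ≤ ε * r ^ (α + 1) := by positivity
  rcases le_or_gt 1 y with hy1 | hy1
  · have hyr : y ≤ r := by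
      refine (sq_le_sq₀ hy.le hr0.le).1 ?_
      nlinarith [sq_nonneg ‖x‖]
    have h2 := hB r x y hy hr hy1 hxy
    have h3 : (y / r) ^ (n + m) ≤ (y / r) ^ n :=
      pow_le_pow_of_le_one (by positivity) ((div_le_one hr0).2 hyr) (Nat.le_add_right _ _)
    have h4 : ‖U (poissonTest hα hy x)‖ * (y / r) ^ (n + m) ≤
        ‖U (poissonTest hα hy x)‖ * (y / r) ^ n :=
      mul_le_mul_of_nonneg_left h3 (norm_nonneg _)
    linarith [le_max_left B B']
  · linarith [hB' r x y hy hr1 hy1 hxy, le_max_right B B']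

end PoissonGrowth

end

/-! ### The theorem -/

theorem theorem5p2 (n : ℕ) (f : 𝓢'(PoissonGrowth.Rn n, ℂ)) :
    ∃ m : ℕ, ∀ α : ℝ, -1 < α →
      f ∈ PoissonGrowth.weightedIntegrable n (α + n + 1) →
        (∃ F : PoissonGrowth.Rn n → ℝ → ℂ, PoissonGrowth.IsPoissonIntegral α f F) ∧
        ∀ F : PoissonGrowth.Rn n → ℝ → ℂ, PoissonGrowth.IsPoissonIntegral α f F →
          (∀ᶠ r : ℝ in atTop, BddAbove (PoissonGrowth.hemisphereValues F (n + m) r)) ∧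
          (fun r : ℝ => sSup (PoissonGrowth.hemisphereValues F (n + m) r))
            =o[atTop] (fun r : ℝ => r ^ (α + 1)) := by
  obtain ⟨m, Cf, hCf0, hf⟩ := PoissonGrowth.exists_schwartz_bound f
  refine ⟨m, fun α hα hfα => ?_⟩
  obtain ⟨N, U, hU, hUf⟩ := PoissonGrowth.exists_isTight_extension hfα
  have hP := PoissonGrowth.isPoissonIntegral_poissonValue hα hU hUf
  refine ⟨⟨_, hP⟩, fun F hF => ?_⟩
  have key : ∀ ε : ℝ, 0 < ε → ∀ᶠ r : ℝ in atTop,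
      ∀ s ∈ PoissonGrowth.hemisphereValues F (n + m) r, s ≤ ε * r ^ (α + 1) := by
    intro ε hε
    filter_upwards [PoissonGrowth.exists_growth_bound hα hU hUf hCf0 hf hε, eventually_gt_atTop 0]
      with r hr hr0
    rintro s ⟨x, y, θ, hy, hxy, -, -, hyθ, -, rfl⟩
    have hcos : Real.cos θ = y / r := by
      rw [hyθ, mul_div_cancel_left₀ _ hr0.ne']
    -- By uniqueness any Poisson integral F agrees at y > 0 with the explicit one, to which the
    -- growth bound applies.
    rw [hF.unique hP x hy, PoissonGrowth.poissonValue_eq U hα x hy, norm_mul, norm_pow,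
      Complex.norm_real, hcos, Real.norm_of_nonneg (by positivity)]
    exact hr x y hy hxy
  refine ⟨?_, ?_⟩
  · filter_upwards [key 1 one_pos] with r hr
    exact ⟨_, hr⟩
  · rw [Asymptotics.isLittleO_iff]
    intro ε hε
    filter_upwards [key ε hε, eventually_gt_atTop 0] with r hr hr0
    have h0 : 0 ≤ sSup (PoissonGrowth.hemisphereValues F (n + m) r) := by
      refine Real.sSup_nonneg ?_
      rintro s ⟨x, y, θ, -, -, -, -, -, -, rfl⟩
      exact norm_nonneg _
    rw [Real.norm_of_nonneg h0, Real.norm_of_nonneg (by positivity)]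
    exact Real.sSup_le hr (by positivity)
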